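/- Let $A\in\mathbb R^{n_s\times n_s}$ be Hurwitz, $B\in\mathbb R^{n_s\times n_a}$, and let $\underline\xi,\overline\xi\in\mathbb R^{n_a\times n_s}$ satisfy $\underline\xi_{ij}\le\overline\xi_{ij}$ for all $i,j$. Put $c_{ij}=\tfrac12(\underline\xi_{ij}+\overline\xi_{ij})$ and $\overline c_{ij}=\overline\xi_{ij}-c_{ij}$. Let $L_2$ (resp. $L_{2e}$) be the space of vector signals on $[0,\infty)$ that are square integrable (resp. square integrable on $[0,T]$ for every $T\ge 0$), signals being identified when they agree almost everywhere. Let $G:u\mapsto x$, $x(t)=\int_0^t e^{A(t-s)}Bu(s)\,ds$, be the zero-initial-state response of $\dot x=Ax+Bu$, and let $W=I_{n_a}\otimes 1_{1\times n_s}$, so that $(Wq)_i=\sum_j q_{ij}$. An operator $\tilde\pi$ from $\mathbb R^{n_s}$-valued signals to $\mathbb R^{n_an_s}$-valued signals is *bounded* if it maps $L_2$ to $L_2$ with finite $L_2$ gain, and *causal* if the restriction of $\tilde\pi(x)$ to $[0,T]$ depends only on the restriction of $x\in L_{2e}$ to $[0,T]$, for every $T\ge0$. It belongs to the sector-bounded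 class $\widetilde{\mathcal P}(\xi)$ if for all $x\in L_2$, $q=\tilde\pi(x)$ and all $i,j$, $$\phi_{ij}(x,q)=(\overline c_{ij}^2-c_{ij}^2)\|x_j\|^2+2c_{ij}\langle q_{ij},x_j\rangle-\|q_{ij}\|^2\ \ge 0,$$ equivalently $\|q_{ij}-c_{ij}x_j\|\le\overline c_{ij}\|x_j\|$ (norms and inner products of $L_2[0,\infty)$). The feedback interconnection of $G$ and $\tilde\pi$ is $$x=Gu,\qquad q=\tilde\pi(x),\qquad u=e+Wq .$$ It is *well posed* if for every $e\in L_{2e}$ there is exactly one solution $u\in L_{2e}$, and this solution depends causally on $e$. It is *input-output stable* if there is a finite $\gamma$ such that $\int_0^T|x(t)|^2dt\le\gamma^2\int_0^T|e(t)|^2dt$ for all $e\in L_{2e}$, all solutions $u\in L_{2e}$ with $x=Gu$, and all $T\ge 0$. For $P=P^\top\in\mathbb R^{n_s\times n_s}$, $\lambda\in\mathbb R^{n_a\times n_s}$ and $\gamma>0$, let $M(\lambda;\xi)$ be the symmetric matrix of the quadratic form $$(x,q)\mapsto\sum_{i,j}\lambda_{ij}\big((\overline c_{ij}^2-c_{ij}^2)x_j^2+2c_{ij}q_{ij}x_j-q_{ij}^2\big)\qquad\text{on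 }\mathbb R^{n_s}\times\mathbb R^{n_an_s},$$ and let $\mathrm{SDP}(P,\lambda,\gamma,\xi)$ be the linear matrix inequality $$\begin{bmatrix}O&S\\S^\top&-\gamma I\end{bmatrix}\prec0,\qquad O=\begin{bmatrix}A^\top P+PA&PBW\\W^\top B^\top P&0\end{bmatrix}+\frac1\gamma\begin{bmatrix}I&0\\0&0\end{bmatrix}+M(\lambda;\xi),\qquad S=\begin{bmatrix}PB\\0\end{bmatrix}.$$ **Theorem.** Suppose that for every bounded causal operator $\tilde\pi\in\widetilde{\mathcal P}(\xi)$ whose interconnection with $G$ is well posed, the interconnection is input-output stable (robust stability over the class). Then there exist $P\succeq0$, $\lambda\ge0$ (entrywise) and $\gamma>0$ such that $\mathrm{SDP}(P,\lambda,\gamma,\xi)$ holds. -/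

import Mathlib

open MeasureTheory Filter
open scoped Matrix

noncomputable section

namespace SectorLoop

/-! ### Signals on the half line `[0, ∞)` -/

/-- A vector signal; only its values at times `t ≥ 0` ever matter, up to a.e. equality. -/
abbrev Signal (ι : Type) : Type := ℝ → ι → ℝ

/-- `x ∈ L₂[0, ∞)`, componentwise. -/
def MemL2 {ι : Type} (x : Signal ι) : Prop :=
  ∀ i, MemLp (fun t => x t i) 2 (volume.restrict (Set.Ici (0 : ℝ)))

/-- `x ∈ L₂ₑ[0, ∞)`: square integrable over each finite horizon `[0, T]`. -/
def MemL2e {ι : Type} (x : Signal ι) : Prop :=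
  ∀ i, ∀ T : ℝ, 0 ≤ T → MemLp (fun t => x t i) 2 (volume.restrict (Set.Icc 0 T))

/-- `∫₀ᵀ |x(t)|₂² dt`. -/
def energyUpTo {ι : Type} [Fintype ι] (T : ℝ) (x : Signal ι) : ℝ :=
  ∫ t in Set.Icc 0 T, ∑ i, x t i ^ 2

/-- `‖x‖₂² = ∫₀^∞ |x(t)|₂² dt`. -/
def energy {ι : Type} [Fintype ι] (x : Signal ι) : ℝ :=
  ∫ t in Set.Ici (0 : ℝ), ∑ i, x t i ^ 2

/-- The inner product `⟨f, g⟩` of scalar signals in `L₂[0, ∞)`. -/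
def inner2 (f g : ℝ → ℝ) : ℝ := ∫ t in Set.Ici (0 : ℝ), f t * g t

/-! ### Operators -/

/-- Causality on `L₂ₑ`: the output on `[0, T]` is determined (a.e.) by the input on `[0, T]`. -/
def Causal {ι κ : Type} (F : Signal ι → Signal κ) : Prop :=
  ∀ T : ℝ, 0 ≤ T → ∀ x y : Signal ι, MemL2e x → MemL2e y →
    x =ᵐ[volume.restrict (Set.Icc 0 T)] y → F x =ᵐ[volume.restrict (Set.Icc 0 T)] F y

/-- Boundedness: `F` maps `L₂` to `L₂` with finite `L₂` gain. -/
def Bounded {ι κ : Type} [Fintype ι] [Fintype κ] (F : Signal ι → Signal κ) : Prop :=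
  ∃ C : ℝ, ∀ x : Signal ι, MemL2 x → MemL2 (F x) ∧ energy (F x) ≤ C ^ 2 * energy x

/-! ### The linear plant -/

/-- Every eigenvalue of `A` has strictly negative real part. -/
def Hurwitz {ns : ℕ} (A : Matrix (Fin ns) (Fin ns) ℝ) : Prop :=
  ∀ μ ∈ spectrum ℂ (A.map (algebraMap ℝ ℂ)), μ.re < 0

/-- The plant `u ↦ x`: the zero-initial-state response of `ẋ = A x + B u`, with the full state
as output, `x(t) = ∫₀ᵗ e^{(t-s)A} B u(s) ds`. -/
def plant {ns na : ℕ} (A : Matrix (Fin ns) (Fin ns) ℝ) (B : Matrix (Fin ns) (Fin na) ℝ)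
    (u : Signal (Fin na)) : Signal (Fin ns) :=
  fun t => ∫ s in (0 : ℝ)..t, NormedSpace.exp ((t - s) • A) *ᵥ (B *ᵥ u s)

/-- `W = I ⊗ 1ᵀ`, so that `(W q)ᵢ = ∑ⱼ qᵢⱼ`. -/
def sumMatrix (na ns : ℕ) : Matrix (Fin na) (Fin na × Fin ns) ℝ :=
  Matrix.of fun i p => if i = p.1 then 1 else 0

/-! ### Sector bounds -/

/-- Centre `cᵢⱼ` of the sector `[lo i j, hi i j]`. -/
def ctr {na ns : ℕ} (lo hi : Fin na → Fin ns → ℝ) (i : Fin na) (j : Fin ns) : ℝ :=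
  (lo i j + hi i j) / 2

/-- Radius `c̄ᵢⱼ = hi i j - cᵢⱼ` of the sector `[lo i j, hi i j]`. -/
def rad {na ns : ℕ} (lo hi : Fin na → Fin ns → ℝ) (i : Fin na) (j : Fin ns) : ℝ :=
  hi i j - ctr lo hi i j

/-- `φᵢⱼ(x, q) = (c̄ᵢⱼ² - cᵢⱼ²) ‖xⱼ‖² + 2 cᵢⱼ ⟨qᵢⱼ, xⱼ⟩ - ‖qᵢⱼ‖²`; nonnegativity says
`‖qᵢⱼ - cᵢⱼ xⱼ‖ ≤ |c̄ᵢⱼ| ‖xⱼ‖`. -/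
def sectorForm {na ns : ℕ} (lo hi : Fin na → Fin ns → ℝ) (i : Fin na) (j : Fin ns)
    (x : Signal (Fin ns)) (q : Signal (Fin na × Fin ns)) : ℝ :=
  (rad lo hi i j ^ 2 - ctr lo hi i j ^ 2) * inner2 (fun t => x t j) (fun t => x t j)
    + 2 * ctr lo hi i j * inner2 (fun t => q t (i, j)) (fun t => x t j)
    - inner2 (fun t => q t (i, j)) (fun t => q t (i, j))

/-- The sector-bounded class of operators: every input-output pair `(x, π x)` with `x ∈ L₂`
satisfies `φᵢⱼ(x, π x) ≥ 0` for all `i`, `j`. -/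
def SectorBounded {na ns : ℕ} (lo hi : Fin na → Fin ns → ℝ)
    (π : Signal (Fin ns) → Signal (Fin na × Fin ns)) : Prop :=
  ∀ x : Signal (Fin ns), MemL2 x → ∀ i j, 0 ≤ sectorForm lo hi i j x (π x)

/-! ### The feedback loop `x = G u`, `q = π x`, `u = e + W q` -/

/-- `u` is the plant input of the loop driven by `e`. -/
def LoopSolution {na ns : ℕ} (A : Matrix (Fin ns) (Fin ns) ℝ) (B : Matrix (Fin ns) (Fin na) ℝ)
    (π : Signal (Fin ns) → Signal (Fin na × Fin ns)) (e u : Signal (Fin na)) : Prop :=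
  ∀ᵐ t ∂(volume.restrict (Set.Ici (0 : ℝ))),
    u t = e t + sumMatrix na ns *ᵥ π (plant A B u) t

/-- Well-posedness: for every `e ∈ L₂ₑ` the loop has exactly one solution `u ∈ L₂ₑ` (up to a.e.
equality), and it depends causally on `e`. -/
def WellPosed {na ns : ℕ} (A : Matrix (Fin ns) (Fin ns) ℝ) (B : Matrix (Fin ns) (Fin na) ℝ)
    (π : Signal (Fin ns) → Signal (Fin na × Fin ns)) : Prop :=
  ∃ H : Signal (Fin na) → Signal (Fin na), Causal H ∧
    ∀ e : Signal (Fin na), MemL2e e →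
      MemL2e (H e) ∧ LoopSolution A B π e (H e) ∧
        ∀ u : Signal (Fin na), MemL2e u → LoopSolution A B π e u →
          u =ᵐ[volume.restrict (Set.Ici (0 : ℝ))] H e

/-- Input-output stability (finite `L₂` gain from `e` to `x`):
`∫₀ᵀ |x|² dt ≤ γ² ∫₀ᵀ |e|² dt` for all `T ≥ 0` along all trajectories of the loop. -/
def IOStable {na ns : ℕ} (A : Matrix (Fin ns) (Fin ns) ℝ) (B : Matrix (Fin ns) (Fin na) ℝ)
    (π : Signal (Fin ns) → Signal (Fin na × Fin ns)) : Prop :=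
  ∃ γ : ℝ, ∀ e u : Signal (Fin na), MemL2e e → MemL2e u → LoopSolution A B π e u →
    ∀ T : ℝ, 0 ≤ T → energyUpTo T (plant A B u) ≤ γ ^ 2 * energyUpTo T e

/-! ### The semidefinite program -/

/-- The multiplier matrix `M(λ; ξ)`, whose quadratic form is
`∑ᵢⱼ λᵢⱼ ((c̄ᵢⱼ² - cᵢⱼ²) xⱼ² + 2 cᵢⱼ qᵢⱼ xⱼ - qᵢⱼ²)`. -/
def multiplier {na ns : ℕ} (lo hi : Fin na → Fin ns → ℝ) (lam : Fin na → Fin ns → ℝ) :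
    Matrix (Fin ns ⊕ Fin na × Fin ns) (Fin ns ⊕ Fin na × Fin ns) ℝ :=
  Matrix.fromBlocks
    (Matrix.diagonal fun j => ∑ i, lam i j * (rad lo hi i j ^ 2 - ctr lo hi i j ^ 2))
    (Matrix.of fun j p => if j = p.2 then lam p.1 p.2 * ctr lo hi p.1 p.2 else 0)
    (Matrix.of fun p j => if j = p.2 then lam p.1 p.2 * ctr lo hi p.1 p.2 else 0)
    (Matrix.diagonal fun p => -lam p.1 p.2)

/-- The block `O(P, λ, ξ)`. -/
def sdpO {na ns : ℕ} (A : Matrix (Fin ns) (Fin ns) ℝ) (B : Matrix (Fin ns) (Fin na) ℝ)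
    (lo hi : Fin na → Fin ns → ℝ) (P : Matrix (Fin ns) (Fin ns) ℝ)
    (lam : Fin na → Fin ns → ℝ) (γ : ℝ) :
    Matrix (Fin ns ⊕ Fin na × Fin ns) (Fin ns ⊕ Fin na × Fin ns) ℝ :=
  Matrix.fromBlocks (Aᵀ * P + P * A) (P * B * sumMatrix na ns)
      ((sumMatrix na ns)ᵀ * Bᵀ * P) 0
    + (1 / γ) • Matrix.fromBlocks 1 0 0 0
    + multiplier lo hi lam

/-- The block `S(P)`. -/
def sdpS {na ns : ℕ} (B : Matrix (Fin ns) (Fin na) ℝ) (P : Matrix (Fin ns) (Fin ns) ℝ) :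
    Matrix (Fin ns ⊕ Fin na × Fin ns) (Fin na) ℝ :=
  Matrix.fromRows (P * B) 0

/-- `SDP(P, λ, γ, ξ)`: the block matrix `[O, S; Sᵀ, -γ I]` is negative definite. -/
def SDP {na ns : ℕ} (A : Matrix (Fin ns) (Fin ns) ℝ) (B : Matrix (Fin ns) (Fin na) ℝ)
    (lo hi : Fin na → Fin ns → ℝ) (P : Matrix (Fin ns) (Fin ns) ℝ)
    (lam : Fin na → Fin ns → ℝ) (γ : ℝ) : Prop :=
  (-(Matrix.fromBlocks (sdpO A B lo hi P lam γ) (sdpS B P) (sdpS B P)ᵀ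
      (-(γ • (1 : Matrix (Fin na) (Fin na) ℝ))))).PosDef

end SectorLoop

end

/-! Drop the `1 / γ` term and the `γ` block from the inequality; what remains, `coreLMI`, is linear
in `(P, λ)`. Either it has a negative definite value with `P` symmetric and `λ ≥ 0`, or it does not.

If it does, openness of negative definiteness and completion of the square give the full inequality
for large `γ` (`exists_SDP_of_coreLMI`). Positivity of `P` is a consequence of stability: along the
loop closed by the static gains at the sector centres, `xᵀ P x` is nonincreasing, so a negative
initial value would keep `x` away from zero and make its energy infinite (`posSemidef_of_stable`).

If it does not, separation of convex cones yields a dual certificate. Regressing its signal part on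
its state part gives a gain `F` and a nonzero `S = Xᵀ X` with `A' S + S A'ᵀ = 0` for `A' = A + B W
F`, such that `F` respects the sector bounds on average over `S` (`coreLMI_alternative`). This
contradicts stability (`not_covariance_of_stable`). Trajectories of `ẋ = A' x` started from the rows
of `X` are concatenated cyclically; in cycle `c` each lasts `τ 4 ^ c` and is scaled by `2 ^ (-c)`.
Stationarity of `S` gives all cycles the same second moments, so the total energy is infinite, while
the jumps are square summable and, `A` being Hurwitz, cost only finite energy. A linear operator in
the class sustains this signal: it applies the centre gains, correlates each cycle of its input with
the reference, and replays the missing part `(F - c) ξ` during the next cycle. Bessel's inequality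
and equality of the cycle moments give the sector bounds; the delay of one cycle gives
well-posedness. An `L₂` disturbance thus produces a state outside `L₂`. -/

namespace SectorLoop

/-- The propagator `e^{tA}` of the autonomous linear system `ẋ = A x`. -/
noncomputable def propagator {n : Type} [Fintype n] [DecidableEq n] (A : Matrix n n ℝ) (t : ℝ) :
    Matrix n n ℝ := NormedSpace.exp (t • A)

/-! ### Matrix exponentials and exponential decay for Hurwitz matrices. -/

section MatrixExp

attribute [local instance] Matrix.linftyOpNormedAddCommGroup Matrix.linftyOpNormedRing
  Matrix.linftyOpNormedSpace Matrix.linftyOpNormedAlgebra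

variable {n : Type} [Fintype n] [DecidableEq n]

lemma propagator_add (A : Matrix n n ℝ) (s t : ℝ) :
    propagator A (s + t) = propagator A s * propagator A t := by
  rw [propagator, add_smul]
  exact Matrix.exp_add_of_commute _ _ (((Commute.refl A).smul_left s).smul_right t)

lemma propagator_zero (A : Matrix n n ℝ) : propagator A 0 = 1 := by
  rw [propagator, zero_smul]
  exact NormedSpace.exp_zero

lemma propagator_mul_neg (A : Matrix n n ℝ) (t : ℝ) :
    propagator A t * propagator A (-t) = 1 := by
  rw [← propagator_add, add_neg_cancel, propagator_zero]

lemma hasDerivAt_propagator_left (A : Matrix n n ℝ) (t : ℝ) :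
    HasDerivAt (propagator A) (A * propagator A t) t :=
  hasDerivAt_exp_smul_const' (𝕂 := ℝ) A t

lemma commute_propagator (A : Matrix n n ℝ) (t : ℝ) :
    A * propagator A t = propagator A t * A :=
  (hasDerivAt_propagator_left A t).unique (hasDerivAt_exp_smul_const (𝕂 := ℝ) A t)

lemma hasDerivAt_propagator_apply (A : Matrix n n ℝ) (t : ℝ) (i j : n) :
    HasDerivAt (fun t => propagator A t i j) ((A * propagator A t) i j) t := by
  have h : HasDerivAt (fun t => Matrix.of.symm (propagator A t)) _ t :=
    ((LinearMap.toContinuousLinearMap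
      (Matrix.ofLinearEquiv ℝ (α := ℝ) (m := n) (n := n)).symm.toLinearMap).hasFDerivAt.comp_hasDerivAt
        t (hasDerivAt_propagator_left A t))
  exact (hasDerivAt_pi.1 (hasDerivAt_pi.1 h i) j)

lemma continuous_propagator (A : Matrix n n ℝ) : Continuous (propagator A) :=
  continuous_iff_continuousAt.2 fun t => (hasDerivAt_propagator_left A t).continuousAt

lemma hasDerivAt_propagator_mulVec (A : Matrix n n ℝ) (v : n → ℝ) (t : ℝ) :
    HasDerivAt (fun t => propagator A t *ᵥ v) (A *ᵥ (propagator A t *ᵥ v)) t := by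
  rw [hasDerivAt_pi]
  intro i
  rw [Matrix.mulVec_mulVec]
  simp only [Matrix.mulVec, dotProduct]
  exact HasDerivAt.fun_sum fun j _ => (hasDerivAt_propagator_apply A t i j).mul_const (v j)

/-- On a generalized eigenvector the exponential of a matrix decays. -/
lemma exp_decay_genEigenvector (A : Matrix n n ℂ) {μ : ℂ} (hμ : μ.re < 0) (k : ℕ) (v : n → ℂ)
    (hv : ((A - μ • (1 : Matrix n n ℂ)) ^ k) *ᵥ v = 0) :
    ∃ C a : ℝ, 0 < a ∧ ∀ t : ℝ, 0 ≤ t →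
      ‖NormedSpace.exp ((t : ℂ) • A) *ᵥ v‖ ≤ C * Real.exp (-a * t) := by
  set N := A - μ • (1 : Matrix n n ℂ) with hN
  have hexp : ∀ t : ℝ, NormedSpace.exp ((t : ℂ) • A) *ᵥ v
      = Complex.exp (t * μ) • ∑ j ∈ Finset.range k, ((j.factorial : ℂ)⁻¹ * (t : ℂ) ^ j) • ((N ^ j) *ᵥ v) := by
    intro t
    have h1 : (t : ℂ) • A = ((t : ℂ) * μ) • (1 : Matrix n n ℂ) + (t : ℂ) • N := by
      rw [hN, smul_sub, smul_smul]; abel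
    have h2 : NormedSpace.exp (((t : ℂ) * μ) • (1 : Matrix n n ℂ))
        = Complex.exp (t * μ) • (1 : Matrix n n ℂ) := by
      rw [Complex.exp_eq_exp_ℂ, ← Algebra.algebraMap_eq_smul_one, ← Algebra.algebraMap_eq_smul_one]
      exact (NormedSpace.algebraMap_exp_comm ((t : ℂ) * μ)).symm
    rw [h1, Matrix.exp_add_of_commute _ _ (by
      rw [← Algebra.algebraMap_eq_smul_one]; exact Algebra.commutes _ _), h2, smul_mul_assoc, one_mul,
      Matrix.smul_mulVec]
    congr 1
    have h3 := NormedSpace.exp_series_hasSum_exp' (𝕂 := ℂ) ((t : ℂ) • N)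
    have h4 : HasSum (fun j : ℕ => (((j.factorial : ℂ)⁻¹ • ((t : ℂ) • N) ^ j)) *ᵥ v)
        (NormedSpace.exp ((t : ℂ) • N) *ᵥ v) :=
      h3.map (⟨⟨fun M : Matrix n n ℂ => M *ᵥ v, Matrix.zero_mulVec v⟩,
        fun M M' => Matrix.add_mulVec M M' v⟩ : Matrix n n ℂ →+ (n → ℂ))
        (by
          change Continuous (fun M : Matrix n n ℂ => M *ᵥ v)
          exact Continuous.matrix_mulVec continuous_id continuous_const)
    -- The exponential series of `N` applied to `v` stops at `k`, because `N ^ k` annihilates `v`.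
    have h5 := hasSum_sum_of_ne_finset_zero
      (f := fun j : ℕ => (((j.factorial : ℂ)⁻¹ • ((t : ℂ) • N) ^ j)) *ᵥ v) (s := Finset.range k) (L := SummationFilter.unconditional ℕ) (by
        intro j hj
        rw [Finset.mem_range, not_lt] at hj
        obtain ⟨i, rfl⟩ := Nat.exists_eq_add_of_le hj
        rw [smul_pow, add_comm k i, pow_add N, Matrix.smul_mulVec, Matrix.smul_mulVec,
          ← Matrix.mulVec_mulVec, hv, Matrix.mulVec_zero, smul_zero, smul_zero])
    rw [h4.unique h5]
    refine Finset.sum_congr rfl fun j _ => ?_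
    rw [smul_pow, Matrix.smul_mulVec, Matrix.smul_mulVec, smul_smul]
  -- Half of the decay rate absorbs the polynomial factor through `(b t) ^ j / j! ≤ exp (b t)`; the
  -- other half remains.
  set b := -μ.re / 2 with hb
  have hb0 : 0 < b := by rw [hb]; linarith
  refine ⟨∑ j ∈ Finset.range k, (b⁻¹) ^ j * ‖(N ^ j) *ᵥ v‖, b, hb0, fun t ht => ?_⟩
  rw [hexp, norm_smul, Complex.norm_exp]
  have hre : ((t : ℂ) * μ).re = -b * t + -b * t := by simp [hb]; ring
  rw [hre, Real.exp_add, mul_assoc, mul_comm]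
  refine mul_le_mul_of_nonneg_right ?_ (Real.exp_pos _).le
  refine (mul_le_mul_of_nonneg_left (norm_sum_le _ _) (Real.exp_pos _).le).trans ?_
  rw [Finset.mul_sum]
  refine Finset.sum_le_sum fun j _ => ?_
  rw [norm_smul, ← mul_assoc]
  refine mul_le_mul_of_nonneg_right ?_ (norm_nonneg _)
  have h6 := Real.pow_div_factorial_le_exp (b * t) (by positivity) j
  have h7 : ‖(j.factorial : ℂ)⁻¹ * (t : ℂ) ^ j‖ = (b⁻¹) ^ j * ((b * t) ^ j / j.factorial) := by
    rw [norm_mul, norm_inv, norm_pow, Complex.norm_natCast, Complex.norm_real, Real.norm_of_nonneg ht,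
      mul_pow, inv_pow]
    field_simp
  rw [h7, neg_mul, Real.exp_neg, ← mul_assoc, mul_comm _ ((b⁻¹) ^ j), mul_assoc]
  refine mul_le_of_le_one_right (by positivity) ?_
  rw [inv_mul_le_one₀ (Real.exp_pos _)]
  exact h6

/-- Vectors with exponentially decaying orbit form a subspace, and the generalized eigenspaces,
which lie in it, span the whole space over `ℂ`. -/
lemma exp_decay_complex (A : Matrix n n ℂ) (hA : ∀ μ ∈ spectrum ℂ A, μ.re < 0) (v : n → ℂ) :
    ∃ C a : ℝ, 0 < a ∧ ∀ t : ℝ, 0 ≤ t →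
      ‖NormedSpace.exp ((t : ℂ) • A) *ᵥ v‖ ≤ C * Real.exp (-a * t) := by
  let S : Submodule ℂ (n → ℂ) :=
    { carrier := {v | ∃ C a : ℝ, 0 < a ∧ ∀ t : ℝ, 0 ≤ t →
        ‖NormedSpace.exp ((t : ℂ) • A) *ᵥ v‖ ≤ C * Real.exp (-a * t)}
      zero_mem' := ⟨0, 1, one_pos, fun t _ => by simp⟩
      add_mem' := by
        rintro v w ⟨C, a, ha, hC⟩ ⟨D, b, hb, hD⟩
        refine ⟨|C| + |D|, min a b, lt_min ha hb, fun t ht => ?_⟩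
        rw [Matrix.mulVec_add, add_mul]
        refine (norm_add_le _ _).trans (add_le_add ((hC t ht).trans ?_) ((hD t ht).trans ?_))
        · exact mul_le_mul (le_abs_self _) (Real.exp_le_exp.2 (by
            nlinarith [min_le_left a b])) (Real.exp_pos _).le (abs_nonneg _)
        · exact mul_le_mul (le_abs_self _) (Real.exp_le_exp.2 (by
            nlinarith [min_le_right a b])) (Real.exp_pos _).le (abs_nonneg _)
      smul_mem' := by
        rintro c v ⟨C, a, ha, hC⟩
        refine ⟨‖c‖ * C, a, ha, fun t ht => ?_⟩
        rw [Matrix.mulVec_smul, norm_smul, mul_assoc]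
        exact mul_le_mul_of_nonneg_left (hC t ht) (norm_nonneg _) }
  suffices h : S = ⊤ by
    have : v ∈ S := h ▸ Submodule.mem_top
    exact this
  let f : Module.End ℂ (n → ℂ) := Matrix.toLinAlgEquiv' A
  rw [eq_top_iff, ← Module.End.iSup_maxGenEigenspace_eq_top f]
  refine iSup_le fun μ w hw => ?_
  obtain ⟨k, hk⟩ := (Module.End.mem_maxGenEigenspace _ _ _).1 hw
  by_cases hμ : μ ∈ spectrum ℂ A
  · refine exp_decay_genEigenvector A (hA μ hμ) k w ?_
    have : (f - μ • (1 : Module.End ℂ (n → ℂ))) ^ k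
        = Matrix.toLinAlgEquiv' ((A - μ • (1 : Matrix n n ℂ)) ^ k) := by
      simp [f]
    rw [this] at hk
    exact hk
  · have h1 : ¬ f.HasEigenvalue μ := by
      intro h
      apply hμ
      have := h.mem_spectrum
      rwa [AlgEquiv.spectrum_eq] at this
    have hker : LinearMap.ker (f - μ • (1 : Module.End ℂ (n → ℂ))) = ⊥ := by
      rw [Module.End.hasEigenvalue_iff, not_not, Module.End.eigenspace_def] at h1
      exact h1
    have hinj : Function.Injective ((f - μ • (1 : Module.End ℂ (n → ℂ))) ^ k) := by
      rw [Module.End.coe_pow]; exact (LinearMap.ker_eq_bot.1 hker).iterate k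
    have hw0 : w = 0 := hinj (by rw [hk, map_zero])
    rw [hw0]
    exact S.zero_mem

lemma Hurwitz.exp_decay {ns : ℕ} {A : Matrix (Fin ns) (Fin ns) ℝ} (hA : Hurwitz A) :
    ∃ C a : ℝ, 0 < C ∧ 0 < a ∧ ∀ t : ℝ, 0 ≤ t → ∀ v : Fin ns → ℝ,
      ‖propagator A t *ᵥ v‖ ≤ C * Real.exp (-a * t) * ‖v‖ := by
  simp only [propagator]
  have key : ∀ j : Fin ns, ∃ C a : ℝ, 0 < a ∧ ∀ t : ℝ, 0 ≤ t →
      ‖NormedSpace.exp (t • A) *ᵥ (Pi.single j (1 : ℝ))‖ ≤ C * Real.exp (-a * t) := by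
    intro j
    obtain ⟨C, a, ha, h⟩ := exp_decay_complex _ hA (Pi.single j 1)
    refine ⟨C, a, ha, fun t ht => le_trans (le_of_eq ?_) (h t ht)⟩
    have h1 : NormedSpace.exp ((t : ℂ) • A.map (algebraMap ℝ ℂ))
        = (NormedSpace.exp (t • A)).map (algebraMap ℝ ℂ) := by
      have h2 : Continuous (fun M : Matrix (Fin ns) (Fin ns) ℝ => M.map (algebraMap ℝ ℂ)) :=
        continuous_id.matrix_map Complex.continuous_ofReal
      have h3 := NormedSpace.map_exp ((algebraMap ℝ ℂ).mapMatrix (m := Fin ns)) h2 (t • A)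
      rw [RingHom.mapMatrix_apply, RingHom.mapMatrix_apply] at h3
      refine Eq.trans (congrArg _ ?_) h3.symm
      ext i j
      simp
    rw [h1, Matrix.mulVec_single_one, Matrix.mulVec_single_one]
    simp only [Pi.norm_def, Matrix.col_apply, Matrix.map_apply]
    simp
  choose C a ha h using key
  obtain ⟨b, hb, hba⟩ : ∃ b : ℝ, 0 < b ∧ ∀ j, b ≤ a j := by
    rcases isEmpty_or_nonempty (Fin ns) with hn | hn
    · exact ⟨1, one_pos, fun j => hn.elim j⟩
    · obtain ⟨j0, hj0⟩ := Finite.exists_min a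
      exact ⟨a j0, ha j0, hj0⟩
  -- The summand `1` only makes the constant strictly positive.
  refine ⟨1 + ∑ j, |C j|, b, by positivity, hb, fun t ht v => ?_⟩
  have hv : NormedSpace.exp (t • A) *ᵥ v
      = ∑ j, v j • (NormedSpace.exp (t • A) *ᵥ (Pi.single j (1 : ℝ))) := by
    simp_rw [← Matrix.mulVec_smul]
    rw [← Matrix.mulVec_sum]
    congr 1
    ext i
    simp [Finset.sum_apply, Pi.single_apply]
  rw [hv]
  calc _ ≤ ∑ j, ‖v‖ * (|C j| * Real.exp (-b * t)) := by
        refine (norm_sum_le _ _).trans (Finset.sum_le_sum fun j _ => ?_)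
        rw [norm_smul]
        refine mul_le_mul (norm_le_pi_norm v j) ((h j t ht).trans ?_) (norm_nonneg _) (norm_nonneg _)
        exact mul_le_mul (le_abs_self _) (Real.exp_le_exp.2 (by nlinarith [hba j]))
          (Real.exp_pos _).le (abs_nonneg _)
    _ = (∑ j, |C j|) * Real.exp (-b * t) * ‖v‖ := by
        rw [← Finset.mul_sum, ← Finset.sum_mul]; ring
    _ ≤ _ := by
        gcongr
        linarith

end MatrixExp

/-! ### Separation of matrix cones and least squares. -/

section Duality

variable {N : Type} [Fintype N] [DecidableEq N]

open scoped MatrixOrder Matrix.Norms.L2Operator in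
lemma exists_eq_conjTranspose_mul_self {Z : Matrix N N ℝ} (hZ : Z.PosSemidef) :
    ∃ Y : Matrix N N ℝ, Z = Yᴴ * Y := by
  obtain ⟨Y, hY⟩ := CStarAlgebra.nonneg_iff_eq_star_mul_self.mp hZ.nonneg
  exact ⟨Y, hY⟩

-- By homogeneity it suffices to test on the compact unit sphere. Symmetry is not imposed, so that
-- the set is open in the space of all matrices, where Hahn–Banach is applied.
omit [DecidableEq N] in
lemma isOpen_setOf_negDef :
    IsOpen {Q : Matrix N N ℝ | ∀ v : N → ℝ, v ≠ 0 → v ⬝ᵥ Q *ᵥ v < 0} := by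
  have hset : {Q : Matrix N N ℝ | ∀ v : N → ℝ, v ≠ 0 → v ⬝ᵥ Q *ᵥ v < 0}
      = {Q : Matrix N N ℝ | ∀ v ∈ Metric.sphere (0 : N → ℝ) 1, v ⬝ᵥ Q *ᵥ v < 0} := by
    ext Q
    refine ⟨fun h v hv => h v (ne_zero_of_mem_unit_sphere ⟨v, hv⟩), fun h v hv => ?_⟩
    have hn : 0 < ‖v‖ := norm_pos_iff.2 hv
    have h1 := h (‖v‖⁻¹ • v) (by
      rw [mem_sphere_zero_iff_norm, norm_smul, norm_inv, norm_norm, inv_mul_cancel₀ hn.ne'])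
    rw [Matrix.mulVec_smul, smul_dotProduct, dotProduct_smul, smul_smul, smul_eq_mul] at h1
    exact (pos_iff_neg_of_mul_neg h1).1 (by positivity)
  rw [hset, isOpen_iff_eventually]
  intro Q hQ
  refine (isCompact_sphere (0 : N → ℝ) 1).eventually_forall_of_forall_eventually fun v hv => ?_
  have hc : Continuous fun z : Matrix N N ℝ × (N → ℝ) => z.2 ⬝ᵥ z.1 *ᵥ z.2 :=
    continuous_snd.dotProduct (continuous_fst.matrix_mulVec continuous_snd)
  exact hc.continuousAt.eventually_lt continuousAt_const (hQ v hv)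

/-- Theorem of alternatives for a convex cone of symmetric matrices: either it contains a negative
definite matrix, or a nonzero positive semidefinite matrix `Bᵀ B` is nonnegative on it. -/
lemma exists_dual_of_no_negDef (K : Set (Matrix N N ℝ)) (h0 : (0 : Matrix N N ℝ) ∈ K)
    (hadd : ∀ Q ∈ K, ∀ R ∈ K, Q + R ∈ K) (hsmul : ∀ c : ℝ, 0 ≤ c → ∀ Q ∈ K, c • Q ∈ K)
    (hsymm : ∀ Q ∈ K, Q.IsSymm) (hK : ∀ Q ∈ K, ¬ (-Q).PosDef) :
    ∃ Y : Matrix N N ℝ, 0 < ∑ k, Y k ⬝ᵥ Y k ∧ ∀ Q ∈ K, 0 ≤ ∑ k, Y k ⬝ᵥ Q *ᵥ Y k := by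
  have hconvU : Convex ℝ {Q : Matrix N N ℝ | ∀ v : N → ℝ, v ≠ 0 → v ⬝ᵥ Q *ᵥ v < 0} := by
    intro Q hQ R hR a b ha hb hab v hv
    rw [Matrix.add_mulVec, dotProduct_add, Matrix.smul_mulVec, Matrix.smul_mulVec, dotProduct_smul,
      dotProduct_smul, smul_eq_mul, smul_eq_mul]
    have h1 := hQ v hv
    have h2 := hR v hv
    rcases ha.eq_or_lt with rfl | ha
    · have : b = 1 := by linarith
      subst this; linarith
    · nlinarith [mul_pos_of_neg_of_neg h1 (neg_lt_zero.2 ha), mul_nonneg hb (neg_pos.2 h2).le]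
  have hconvK : Convex ℝ K := fun Q hQ R hR a b ha hb _ =>
    hadd _ (hsmul a ha Q hQ) _ (hsmul b hb R hR)
  have hdisj : Disjoint {Q : Matrix N N ℝ | ∀ v : N → ℝ, v ≠ 0 → v ⬝ᵥ Q *ᵥ v < 0} K := by
    rw [Set.disjoint_left]
    intro Q hQU hQK
    refine hK Q hQK (Matrix.PosDef.of_dotProduct_mulVec_pos ?_ fun v hv => ?_)
    · rw [Matrix.IsHermitian, Matrix.conjTranspose_eq_transpose_of_trivial, Matrix.transpose_neg,
        hsymm Q hQK]
    · rw [Matrix.neg_mulVec, dotProduct_neg, star_trivial]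
      exact neg_pos.2 (hQU v hv)
  obtain ⟨f, u, hfU, hfK⟩ := geometric_hahn_banach_open hconvU isOpen_setOf_negDef hconvK hdisj
  have hu : u ≤ 0 := by simpa using hfK 0 h0
  have hfK0 : ∀ Q ∈ K, 0 ≤ f Q := by
    intro Q hQ
    by_contra! hneg
    -- This multiple of `Q` has `f`-value `u - 1`, below the separating level.
    have h1 := hfK _ (hsmul ((u - 1) / f Q) (div_nonneg_of_nonpos (by linarith) hneg.le) Q hQ)
    rw [map_smul, smul_eq_mul, div_mul_cancel₀ _ hneg.ne] at h1
    linarith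
  have hself : ∀ v : N → ℝ, v ≠ 0 → 0 < v ⬝ᵥ v := fun v hv =>
    lt_of_le_of_ne (Finset.sum_nonneg fun i _ => mul_self_nonneg _)
      (Ne.symm (by simpa using hv))
  have hf1 : 0 < f 1 := by
    have := hfU (-1) (fun v hv => by
      rw [Matrix.neg_mulVec, Matrix.one_mulVec, dotProduct_neg]
      exact neg_lt_zero.2 (hself v hv))
    rw [map_neg] at this
    linarith
  have hfv : ∀ v : N → ℝ, 0 ≤ f (Matrix.vecMulVec v v) := by
    intro v
    by_contra! hneg
    -- The multiple of `1` is chosen so that `f` vanishes on this negative definite matrix, against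
    -- `f < u ≤ 0` there.
    have h1 := hfU (-(Matrix.vecMulVec v v) - (-(f (Matrix.vecMulVec v v)) / (f 1)) • 1) (fun w hw => by
      rw [Matrix.sub_mulVec, Matrix.neg_mulVec, dotProduct_sub, dotProduct_neg, Matrix.smul_mulVec,
        Matrix.one_mulVec, dotProduct_smul, smul_eq_mul, Matrix.vecMulVec_mulVec]
      have h2 : 0 < -(f (Matrix.vecMulVec v v)) / (f 1) := div_pos (neg_pos.2 hneg) hf1
      have h3 : w ⬝ᵥ (MulOpposite.op (v ⬝ᵥ w) • v) = (v ⬝ᵥ w) ^ 2 := by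
        rw [op_smul_eq_smul, dotProduct_smul, smul_eq_mul, dotProduct_comm w v, sq]
      rw [h3]
      nlinarith [mul_pos h2 (hself w hw), sq_nonneg (v ⬝ᵥ w)])
    rw [map_sub, map_neg, map_smul, smul_eq_mul, div_mul_cancel₀ _ hf1.ne'] at h1
    linarith
  have hfsum : ∀ Q : Matrix N N ℝ, f Q = ∑ a, ∑ b, Q a b * f (Matrix.single a b 1) := by
    intro Q
    conv_lhs => rw [Matrix.matrix_eq_sum_single Q]
    rw [map_sum]
    refine Finset.sum_congr rfl fun a _ => ?_
    rw [map_sum]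
    refine Finset.sum_congr rfl fun b _ => ?_
    rw [← smul_eq_mul, ← map_smul, Matrix.smul_single, smul_eq_mul, mul_one]
  -- The coefficient matrix of `f`, symmetrized: this changes nothing on symmetric matrices. A
  -- factorization `Z = Yᵀ Y` then turns `f Q` into a sum of values of the form `Q` at the rows of
  -- `Y`.
  let Z : Matrix N N ℝ := Matrix.of fun a b =>
    (f (Matrix.single a b 1) + f (Matrix.single b a 1)) / 2
  have hZ : ∀ Q : Matrix N N ℝ, Q.IsSymm → ∑ a, ∑ b, Q a b * Z a b = f Q := by
    intro Q hQ
    have h1 : ∑ a, ∑ b, Q a b * f (Matrix.single b a 1) = f Q := by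
      rw [Finset.sum_comm, hfsum Q]
      refine Finset.sum_congr rfl fun a _ => Finset.sum_congr rfl fun b _ => ?_
      rw [hQ.apply]
    calc _ = (∑ a, ∑ b, Q a b * f (Matrix.single a b 1)
          + ∑ a, ∑ b, Q a b * f (Matrix.single b a 1)) / 2 := by
          simp only [Z, Matrix.of_apply, ← Finset.sum_add_distrib, Finset.sum_div]
          refine Finset.sum_congr rfl fun a _ => Finset.sum_congr rfl fun b _ => ?_
          ring
      _ = f Q := by rw [h1, ← hfsum]; ring
  have hZpsd : Z.PosSemidef := by
    refine Matrix.PosSemidef.of_dotProduct_mulVec_nonneg ?_ fun v => ?_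
    · ext a b
      simp [Z, add_comm]
    · rw [star_trivial]
      have h1 := hfv v
      rw [← hZ _ (by ext a b; simp [Matrix.vecMulVec, mul_comm])] at h1
      refine h1.trans (le_of_eq ?_)
      simp only [dotProduct, Matrix.mulVec, Matrix.vecMulVec_apply, Finset.mul_sum]
      refine Finset.sum_congr rfl fun a _ => Finset.sum_congr rfl fun b _ => ?_
      ring
  obtain ⟨Y, hY⟩ := exists_eq_conjTranspose_mul_self hZpsd
  have hquad : ∀ Q : Matrix N N ℝ, Q.IsSymm → ∑ k, Y k ⬝ᵥ Q *ᵥ Y k = f Q := by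
    intro Q hQ
    rw [← hZ Q hQ, hY]
    simp only [Matrix.mul_apply, Matrix.conjTranspose_apply, star_trivial, dotProduct, Matrix.mulVec,
      Finset.mul_sum]
    rw [Finset.sum_comm]
    refine Finset.sum_congr rfl fun a _ => ?_
    rw [Finset.sum_comm]
    refine Finset.sum_congr rfl fun b _ => Finset.sum_congr rfl fun k _ => ?_
    ring
  refine ⟨Y, ?_, fun Q hQ => ?_⟩
  · have := hquad 1 Matrix.isSymm_one
    simp only [Matrix.one_mulVec] at this
    rw [this]; exact hf1
  · rw [hquad Q (hsymm Q hQ)]; exact hfK0 Q hQ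

/-- Solvability of the normal equations. -/
lemma exists_normal_equation {m n p : Type} [Fintype m] [Fintype n] [DecidableEq n]
    (X : Matrix m n ℝ) (Q : Matrix m p ℝ) :
    ∃ F : Matrix p n ℝ, Xᵀ * (Q - X * Fᵀ) = 0 := by
  -- Equality of ranks makes the equations solvable even when `X` is rank deficient.
  have hrange : LinearMap.range (Xᵀ * X).mulVecLin = LinearMap.range Xᵀ.mulVecLin := by
    refine Submodule.eq_of_le_of_finrank_eq ?_ ?_
    · rw [Matrix.mulVecLin_mul]; exact LinearMap.range_comp_le_range _ _
    · have := Matrix.rank_transpose_mul_self X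
      rw [← Matrix.rank_transpose X] at this
      exact this
  have h : ∀ j : p, ∃ g : n → ℝ, (Xᵀ * X) *ᵥ g = Xᵀ *ᵥ (fun k => Q k j) := by
    intro j
    have : Xᵀ *ᵥ (fun k => Q k j) ∈ LinearMap.range (Xᵀ * X).mulVecLin := by
      rw [hrange]; exact ⟨_, rfl⟩
    exact this
  choose g hg using h
  refine ⟨Matrix.of g, ?_⟩
  rw [Matrix.mul_sub, ← Matrix.mul_assoc, sub_eq_zero]
  ext a j
  exact (congrFun (hg j) a).symm

end Duality

/-! ### The core matrix inequality, its dual alternative, and recovery of the full program. -/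

section LMI

variable {ns na : ℕ}

/-- The upper left block of the semidefinite program, without the `1 / γ` term. -/
noncomputable def coreLMI (A : Matrix (Fin ns) (Fin ns) ℝ) (B : Matrix (Fin ns) (Fin na) ℝ)
    (lo hi : Fin na → Fin ns → ℝ) (P : Matrix (Fin ns) (Fin ns) ℝ) (lam : Fin na → Fin ns → ℝ) :
    Matrix (Fin ns ⊕ Fin na × Fin ns) (Fin ns ⊕ Fin na × Fin ns) ℝ :=
  Matrix.fromBlocks (Aᵀ * P + P * A) (P * B * sumMatrix na ns)
      ((sumMatrix na ns)ᵀ * Bᵀ * P) 0 + multiplier lo hi lam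

lemma multiplier_isSymm (lo hi lam : Fin na → Fin ns → ℝ) : (multiplier lo hi lam).IsSymm := by
  refine Matrix.IsSymm.fromBlocks (Matrix.isSymm_diagonal _) ?_ (Matrix.isSymm_diagonal _)
  ext p j
  simp

lemma coreLMI_isSymm (A : Matrix (Fin ns) (Fin ns) ℝ) (B : Matrix (Fin ns) (Fin na) ℝ)
    (lo hi : Fin na → Fin ns → ℝ) {P : Matrix (Fin ns) (Fin ns) ℝ} (hP : P.IsSymm)
    (lam : Fin na → Fin ns → ℝ) : (coreLMI A B lo hi P lam).IsSymm := by
  refine Matrix.IsSymm.add (Matrix.IsSymm.fromBlocks ?_ ?_ Matrix.isSymm_zero)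
    (multiplier_isSymm lo hi lam)
  · rw [Matrix.IsSymm, Matrix.transpose_add, Matrix.transpose_mul, Matrix.transpose_mul,
      Matrix.transpose_transpose, hP.eq, add_comm]
  · rw [Matrix.transpose_mul, Matrix.transpose_mul, hP.eq, Matrix.mul_assoc]

lemma multiplier_quadForm (lo hi lam : Fin na → Fin ns → ℝ) (v : Fin ns ⊕ Fin na × Fin ns → ℝ) :
    v ⬝ᵥ multiplier lo hi lam *ᵥ v = ∑ i, ∑ j, lam i j *
      ((rad lo hi i j ^ 2 - ctr lo hi i j ^ 2) * v (Sum.inl j) ^ 2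
        + 2 * ctr lo hi i j * v (Sum.inr (i, j)) * v (Sum.inl j) - v (Sum.inr (i, j)) ^ 2) := by
  rw [multiplier, Matrix.fromBlocks_mulVec]
  simp only [dotProduct, Fintype.sum_sum_type, Sum.elim_inl, Sum.elim_inr, Pi.add_apply,
    Matrix.mulVec_diagonal]
  simp only [Matrix.mulVec, dotProduct, Matrix.of_apply, Function.comp_apply, ite_mul, zero_mul,
    Finset.sum_ite_eq', Finset.mem_univ, if_true, Fintype.sum_prod_type, Finset.sum_ite_eq]
  simp only [mul_add, Finset.sum_add_distrib, Finset.sum_mul, Finset.mul_sum]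
  rw [Finset.sum_comm, Finset.sum_comm (s := (Finset.univ : Finset (Fin ns)))]
  simp only [← Finset.sum_add_distrib]
  refine Finset.sum_congr rfl fun i _ => Finset.sum_congr rfl fun j _ => ?_
  ring

lemma coreLMI_quadForm (A : Matrix (Fin ns) (Fin ns) ℝ) (B : Matrix (Fin ns) (Fin na) ℝ)
    (lo hi : Fin na → Fin ns → ℝ) {P : Matrix (Fin ns) (Fin ns) ℝ} (hP : P.IsSymm)
    (lam : Fin na → Fin ns → ℝ) (v : Fin ns ⊕ Fin na × Fin ns → ℝ) :
    v ⬝ᵥ coreLMI A B lo hi P lam *ᵥ v =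
      2 * ((v ∘ Sum.inl) ⬝ᵥ P *ᵥ (A *ᵥ (v ∘ Sum.inl) + B *ᵥ (sumMatrix na ns *ᵥ (v ∘ Sum.inr))))
      + v ⬝ᵥ multiplier lo hi lam *ᵥ v := by
  rw [coreLMI, Matrix.add_mulVec, dotProduct_add, Matrix.fromBlocks_mulVec]
  congr 1
  set x := v ∘ Sum.inl with hx
  set q := v ∘ Sum.inr with hq
  have hv : v = Sum.elim x q := (Sum.elim_comp_inl_inr v).symm
  conv_lhs => rw [hv, sumElim_dotProduct_sumElim]
  have h1 : x ⬝ᵥ (Aᵀ * P) *ᵥ x = x ⬝ᵥ (P * A) *ᵥ x := by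
    have : (Aᵀ * P) = (P * A)ᵀ := by rw [Matrix.transpose_mul, hP.eq]
    rw [this, Matrix.mulVec_transpose, dotProduct_comm, ← Matrix.dotProduct_mulVec]
  have h2 : q ⬝ᵥ ((sumMatrix na ns)ᵀ * Bᵀ * P) *ᵥ x = x ⬝ᵥ (P * B * sumMatrix na ns) *ᵥ q := by
    have : (sumMatrix na ns)ᵀ * Bᵀ * P = (P * B * sumMatrix na ns)ᵀ := by
      rw [Matrix.transpose_mul, Matrix.transpose_mul, hP.eq, Matrix.mul_assoc]
    rw [this, Matrix.mulVec_transpose, dotProduct_comm, ← Matrix.dotProduct_mulVec]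
  rw [Matrix.add_mulVec, dotProduct_add, dotProduct_add, dotProduct_add, h1, h2, Matrix.zero_mulVec,
    dotProduct_zero, Matrix.mulVec_add, dotProduct_add, Matrix.mulVec_mulVec, Matrix.mulVec_mulVec,
    Matrix.mulVec_mulVec, Matrix.mul_assoc P B]
  ring

/-- If the core inequality has no solution, then the linear system `ẋ = (A + B W F) x` has a
stationary covariance `Xᵀ X` compatible with all sector bounds. -/
theorem coreLMI_alternative (A : Matrix (Fin ns) (Fin ns) ℝ) (B : Matrix (Fin ns) (Fin na) ℝ)
    (lo hi : Fin na → Fin ns → ℝ)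
    (h : ¬ ∃ (P : Matrix (Fin ns) (Fin ns) ℝ) (lam : Fin na → Fin ns → ℝ), P.IsSymm ∧
      (∀ i j, 0 ≤ lam i j) ∧ (-coreLMI A B lo hi P lam).PosDef) :
    ∃ (m : Type) (_ : Fintype m) (X : Matrix m (Fin ns) ℝ) (F : Matrix (Fin na × Fin ns) (Fin ns) ℝ),
      (A + B * sumMatrix na ns * F) * (Xᵀ * X) + (Xᵀ * X) * (A + B * sumMatrix na ns * F)ᵀ = 0 ∧
      0 < ∑ j, (Xᵀ * X) j j ∧
      ∀ i j, (F (i, j) - Pi.single j (ctr lo hi i j)) ⬝ᵥ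
          (Xᵀ * X) *ᵥ (F (i, j) - Pi.single j (ctr lo hi i j))
        ≤ rad lo hi i j ^ 2 * (Xᵀ * X) j j := by
  have hadd : ∀ P P' lam lam', coreLMI A B lo hi P lam + coreLMI A B lo hi P' lam'
      = coreLMI A B lo hi (P + P') (lam + lam') := by
    intro P P' lam lam'
    rw [coreLMI, coreLMI, coreLMI, multiplier, multiplier, multiplier, Matrix.fromBlocks_add,
      Matrix.fromBlocks_add, Matrix.fromBlocks_add, Matrix.fromBlocks_add]
    congr 1
    · ext a b
      by_cases hab : a = b
      · subst hab
        simp [Matrix.mul_add, add_mul, Finset.sum_add_distrib]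
        ring
      · simp [Matrix.mul_add, Matrix.add_mul, hab]
        ring
    · ext a b
      by_cases hab : a = b.2
      · simp [Matrix.add_mul, hab]
        ring
      · simp [Matrix.add_mul, hab]
    · ext b a
      by_cases hab : a = b.2
      · simp [Matrix.mul_add, hab]
        ring
      · simp [Matrix.mul_add, hab]
    · ext a b
      by_cases hab : a = b
      · subst hab
        simp
        ring
      · simp [hab]
  have hsmul : ∀ (c : ℝ) P lam, c • coreLMI A B lo hi P lam = coreLMI A B lo hi (c • P) (c • lam) := by
    intro c P lam
    rw [coreLMI, coreLMI, multiplier, multiplier, Matrix.fromBlocks_add, Matrix.fromBlocks_add,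
      Matrix.fromBlocks_smul]
    congr 1
    · ext a b
      by_cases hab : a = b
      · subst hab
        simp [mul_add, Finset.mul_sum, mul_assoc]
      · simp [mul_add, hab]
    · ext a b
      by_cases hab : a = b.2
      · simp [mul_add, hab, mul_assoc]
      · simp [hab]
    · ext b a
      by_cases hab : a = b.2
      · simp [mul_add, hab, mul_assoc]
      · simp [hab]
    · ext a b
      by_cases hab : a = b
      · subst hab
        simp
      · simp [hab]
  have hzero : coreLMI A B lo hi 0 0 = 0 := by simpa using (hsmul 0 0 0).symm
  obtain ⟨Y, hYpos, hY⟩ := exists_dual_of_no_negDef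
    {Q | ∃ (P : Matrix (Fin ns) (Fin ns) ℝ) (lam : Fin na → Fin ns → ℝ), P.IsSymm ∧
      (∀ i j, 0 ≤ lam i j) ∧ coreLMI A B lo hi P lam = Q}
    ⟨0, 0, Matrix.isSymm_zero, fun _ _ => le_rfl, hzero⟩
    (by
      rintro _ ⟨P, lam, hP, hl, rfl⟩ _ ⟨P', lam', hP', hl', rfl⟩
      exact ⟨P + P', lam + lam', hP.add hP', fun i j => add_nonneg (hl i j) (hl' i j),
        (hadd _ _ _ _).symm⟩)
    (by
      rintro c hc _ ⟨P, lam, hP, hl, rfl⟩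
      exact ⟨c • P, c • lam, hP.smul c, fun i j => mul_nonneg hc (hl i j), (hsmul _ _ _).symm⟩)
    (by
      rintro _ ⟨P, lam, hP, hl, rfl⟩
      exact coreLMI_isSymm A B lo hi hP lam)
    (by
      rintro _ ⟨P, lam, hP, hl, rfl⟩ hneg
      exact h ⟨P, lam, hP, hl, hneg⟩)
  let X : Matrix (Fin ns ⊕ Fin na × Fin ns) (Fin ns) ℝ := Matrix.of fun k j => Y k (Sum.inl j)
  let Q : Matrix (Fin ns ⊕ Fin na × Fin ns) (Fin na × Fin ns) ℝ :=
    Matrix.of fun k j => Y k (Sum.inr j)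
  -- `F` is the least-squares regression of the signal part on the state part; the residual is
  -- orthogonal to the columns of `X`.
  obtain ⟨F, hF⟩ := exists_normal_equation X Q
  set W := sumMatrix na ns with hW
  have hXQ : Xᵀ * Q = Xᵀ * X * Fᵀ := by
    rw [Matrix.mul_sub, sub_eq_zero] at hF
    rw [hF, Matrix.mul_assoc]
  -- Both `P` and `-P` are admissible, so the dual inequality is an equality in `P`.
  have hlin : ∀ P : Matrix (Fin ns) (Fin ns) ℝ, P.IsSymm →
      ∑ k, X k ⬝ᵥ P *ᵥ (A *ᵥ X k + B *ᵥ (W *ᵥ Q k)) = 0 := by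
    have hle : ∀ P : Matrix (Fin ns) (Fin ns) ℝ, P.IsSymm →
        0 ≤ ∑ k, X k ⬝ᵥ P *ᵥ (A *ᵥ X k + B *ᵥ (W *ᵥ Q k)) := by
      intro P hP
      have h1 := hY _ ⟨P, 0, hP, fun _ _ => le_rfl, rfl⟩
      simp only [coreLMI_quadForm A B lo hi hP, multiplier_quadForm, Pi.zero_apply, zero_mul,
        Finset.sum_const_zero, add_zero, ← Finset.mul_sum] at h1
      exact nonneg_of_mul_nonneg_right h1 two_pos
    intro P hP
    refine le_antisymm ?_ (hle P hP)
    have h1 := hle (-P) hP.neg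
    simp only [Matrix.neg_mulVec, dotProduct_neg, Finset.sum_neg_distrib] at h1
    linarith
  -- Test with `P = 0` and a single unit multiplier.
  have hsec : ∀ i j, 0 ≤ ∑ k, ((rad lo hi i j ^ 2 - ctr lo hi i j ^ 2) * X k j ^ 2
      + 2 * ctr lo hi i j * Q k (i, j) * X k j - Q k (i, j) ^ 2) := by
    intro i j
    have h1 := hY _ ⟨0, Pi.single i (Pi.single j 1), Matrix.isSymm_zero, fun i' j' => by
      by_cases hi' : i' = i
      · subst hi'
        by_cases hj' : j' = j
        · subst hj'; simp
        · simp [hj']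
      · simp [hi'], rfl⟩
    simp only [coreLMI_quadForm A B lo hi Matrix.isSymm_zero, multiplier_quadForm,
      Matrix.zero_mulVec, dotProduct_zero, mul_zero, zero_add] at h1
    refine h1.trans (le_of_eq (Finset.sum_congr rfl fun k _ => ?_))
    rw [Finset.sum_eq_single i (fun i' _ hi' => by simp [hi']) (by simp),
      Finset.sum_eq_single j (fun j' _ hj' => by simp [hj']) (by simp)]
    simp [X, Q]
  refine ⟨_, inferInstance, X, F, ?_, ?_, ?_⟩
  · have hsym : Xᵀ * (X * Aᵀ + Q * Wᵀ * Bᵀ) + (Xᵀ * (X * Aᵀ + Q * Wᵀ * Bᵀ))ᵀ = 0 := by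
      ext a b
      have h1 := hlin (Matrix.single a b 1 + Matrix.single b a 1) (by
        ext i j; simp [Matrix.single_apply, add_comm, and_comm])
      have h2 : ∀ k, (X * Aᵀ + Q * Wᵀ * Bᵀ) k = A *ᵥ X k + B *ᵥ (W *ᵥ Q k) := by
        intro k
        ext i
        rw [Matrix.mulVec_mulVec, Pi.add_apply, Matrix.add_apply, Matrix.mul_assoc,
          ← Matrix.transpose_mul]
        simp only [Matrix.mul_apply, Matrix.mulVec, dotProduct, Matrix.transpose_apply]
        congr 1 <;> exact Finset.sum_congr rfl fun _ _ => mul_comm _ _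
      rw [Matrix.zero_apply, ← h1, Matrix.add_apply, Matrix.transpose_apply, Matrix.mul_apply,
        Matrix.mul_apply, ← Finset.sum_add_distrib]
      refine Finset.sum_congr rfl fun k _ => ?_
      have h3 : ∀ (a b : Fin ns) (w : Fin ns → ℝ),
          Matrix.single a b (1 : ℝ) *ᵥ w = Pi.single a (w b) := fun a b w => by
        rw [Matrix.single_mulVec, one_mul]; rfl
      rw [h2, Matrix.add_mulVec, dotProduct_add, h3, h3, dotProduct_single, dotProduct_single,
        Matrix.transpose_apply, Matrix.transpose_apply]
    have h3 : Xᵀ * (X * Aᵀ + Q * Wᵀ * Bᵀ) = Xᵀ * X * (A + B * W * F)ᵀ := by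
      rw [Matrix.mul_add, ← Matrix.mul_assoc, ← Matrix.mul_assoc, ← Matrix.mul_assoc, hXQ,
        Matrix.transpose_add, Matrix.mul_add, Matrix.transpose_mul, Matrix.transpose_mul]
      simp only [Matrix.mul_assoc]
    rw [h3] at hsym
    rw [← hsym, Matrix.transpose_mul, Matrix.transpose_transpose, Matrix.transpose_mul,
      Matrix.transpose_transpose, add_comm]
  · have hS : ∀ j, (Xᵀ * X) j j = ∑ k, X k j ^ 2 := fun j => by
      simp [Matrix.mul_apply, sq]
    by_contra! hneg
    simp only [hS] at hneg
    have hX0 : ∀ k j, X k j = 0 := by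
      have h1 := (Finset.sum_eq_zero_iff_of_nonneg (fun j _ => Finset.sum_nonneg fun k _ =>
        sq_nonneg (X k j))).1 (le_antisymm hneg (Finset.sum_nonneg fun j _ =>
          Finset.sum_nonneg fun k _ => sq_nonneg (X k j)))
      intro k j
      have h2 := (Finset.sum_eq_zero_iff_of_nonneg (fun k _ => sq_nonneg (X k j))).1
        (h1 j (Finset.mem_univ j)) k (Finset.mem_univ k)
      exact pow_eq_zero_iff two_ne_zero |>.1 h2
    -- With `X = 0` the sector inequalities leave only `-∑ Q²`, hence `Y = 0`, against its
    -- normalization.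
    have hQ0 : ∀ k p, Q k p = 0 := by
      rintro k ⟨i, j⟩
      have h1 := hsec i j
      simp only [hX0, ne_eq, OfNat.ofNat_ne_zero, not_false_eq_true, zero_pow, mul_zero,
        zero_sub, add_zero, Finset.sum_neg_distrib] at h1
      have h2 := (Finset.sum_eq_zero_iff_of_nonneg (fun k _ => sq_nonneg (Q k (i, j)))).1
        (le_antisymm (by linarith) (Finset.sum_nonneg fun k _ => sq_nonneg (Q k (i, j)))) k
        (Finset.mem_univ k)
      exact pow_eq_zero_iff two_ne_zero |>.1 h2
    have : ∀ k, Y k = 0 := fun k => by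
      ext (j | p)
      · exact hX0 k j
      · exact hQ0 k p
    simp [this] at hYpos
  · intro i j
    set c := ctr lo hi i j
    set g := F (i, j) - Pi.single j c with hg
    have hR : ∀ a, ∑ k, X k a * (Q k (i, j) - X k ⬝ᵥ F (i, j)) = 0 := fun a =>
      congrFun (congrFun hF a) (i, j)
    have hXg : ∀ k, X k ⬝ᵥ g = X k ⬝ᵥ F (i, j) - c * X k j := fun k => by
      rw [hg, dotProduct_sub, dotProduct_single, mul_comm]
    have hRg : ∑ k, (X k ⬝ᵥ g) * (Q k (i, j) - X k ⬝ᵥ F (i, j)) = 0 := by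
      simp only [dotProduct.eq_1 (X _) g, Finset.sum_mul]
      rw [Finset.sum_comm]
      refine Finset.sum_eq_zero fun a _ => ?_
      have := hR a
      calc _ = g a * ∑ k, X k a * (Q k (i, j) - X k ⬝ᵥ F (i, j)) := by
            rw [Finset.mul_sum]
            exact Finset.sum_congr rfl fun k _ => by ring
        _ = 0 := by rw [this, mul_zero]
    have hgS : g ⬝ᵥ (Xᵀ * X) *ᵥ g = ∑ k, (X k ⬝ᵥ g) ^ 2 := by
      rw [← Matrix.mulVec_mulVec, Matrix.dotProduct_mulVec, Matrix.vecMul_transpose]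
      simp [dotProduct.eq_1 (X *ᵥ g), Matrix.mulVec, sq]
    have hS : (Xᵀ * X) j j = ∑ k, X k j ^ 2 := by
      simp [Matrix.mul_apply, sq]
    rw [hgS, hS, ← sub_nonneg]
    -- Pythagoras: `Q - c Xⱼ` is `X g` plus the orthogonal residual, so replacing `Q` by its
    -- regression only shortens the distance to the sector centre.
    have h1 : ∑ k, ((rad lo hi i j ^ 2 - c ^ 2) * X k j ^ 2
          + 2 * c * Q k (i, j) * X k j - Q k (i, j) ^ 2)
        = (rad lo hi i j ^ 2 * ∑ k, X k j ^ 2 - ∑ k, (X k ⬝ᵥ g) ^ 2)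
          - 2 * ∑ k, (X k ⬝ᵥ g) * (Q k (i, j) - X k ⬝ᵥ F (i, j))
          - ∑ k, (Q k (i, j) - X k ⬝ᵥ F (i, j)) ^ 2 := by
      rw [Finset.mul_sum, Finset.mul_sum, ← Finset.sum_sub_distrib, ← Finset.sum_sub_distrib,
        ← Finset.sum_sub_distrib]
      refine Finset.sum_congr rfl fun k _ => ?_
      rw [hXg]
      ring
    have h2 := hsec i j
    rw [h1, hRg] at h2
    have h3 : 0 ≤ ∑ k, (Q k (i, j) - X k ⬝ᵥ F (i, j)) ^ 2 :=
      Finset.sum_nonneg fun k _ => sq_nonneg _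
    linarith

/-- A strict solution of the core inequality solves the semidefinite program for large `γ`. -/
theorem exists_SDP_of_coreLMI (A : Matrix (Fin ns) (Fin ns) ℝ) (B : Matrix (Fin ns) (Fin na) ℝ)
    (lo hi : Fin na → Fin ns → ℝ) {P : Matrix (Fin ns) (Fin ns) ℝ} (hP : P.IsSymm)
    (lam : Fin na → Fin ns → ℝ) (h : (-coreLMI A B lo hi P lam).PosDef) :
    ∃ γ : ℝ, 0 < γ ∧ SDP A B lo hi P lam γ := by
  set S := sdpS B P with hS
  set C := coreLMI A B lo hi P lam with hC
  set D : Matrix (Fin ns ⊕ Fin na × Fin ns) (Fin ns ⊕ Fin na × Fin ns) ℝ :=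
    Matrix.fromBlocks 1 0 0 0 with hD
  have hCsymm : C.IsSymm := coreLMI_isSymm A B lo hi hP lam
  have hCneg : C ∈ {Q : Matrix (Fin ns ⊕ Fin na × Fin ns) (Fin ns ⊕ Fin na × Fin ns) ℝ |
      ∀ v : _ → ℝ, v ≠ 0 → v ⬝ᵥ Q *ᵥ v < 0} := by
    intro v hv
    have := h.dotProduct_mulVec_pos hv
    rw [star_trivial, Matrix.neg_mulVec, dotProduct_neg] at this
    linarith
  -- The term `2 S Sᵀ / γ` is the cost of completing the square in `e` while spending only half of
  -- `γ |e|²`; the other half gives strictness when the `(x, q)` part vanishes.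
  have htend : Tendsto (fun γ : ℝ => C + (1 / γ) • (D + (2 : ℝ) • (S * Sᵀ))) atTop (nhds C) := by
    have h1 : Tendsto (fun γ : ℝ => 1 / γ) atTop (nhds 0) := by
      simpa using tendsto_inv_atTop_zero (𝕜 := ℝ)
    simpa using (h1.smul_const (D + (2 : ℝ) • (S * Sᵀ))).const_add C
  obtain ⟨γ, hγ, hγ0⟩ := ((htend.eventually (isOpen_setOf_negDef.mem_nhds hCneg)).and
    (eventually_gt_atTop 0)).exists
  refine ⟨γ, hγ0, ?_⟩
  have hO : sdpO A B lo hi P lam γ = C + (1 / γ) • D := by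
    rw [sdpO, hC, coreLMI]; abel
  have hDs : D.IsSymm := Matrix.IsSymm.fromBlocks Matrix.isSymm_one (by simp) Matrix.isSymm_zero
  refine Matrix.PosDef.of_dotProduct_mulVec_pos ?_ fun v hv => ?_
  · rw [Matrix.IsHermitian, Matrix.conjTranspose_eq_transpose_of_trivial, Matrix.transpose_neg,
      Matrix.fromBlocks_transpose, Matrix.transpose_transpose, hO, Matrix.transpose_add,
      Matrix.transpose_smul, hCsymm.eq, hDs.eq]
    simp
  · rw [star_trivial, Matrix.neg_mulVec, dotProduct_neg, neg_pos, Matrix.fromBlocks_mulVec, hO]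
    set z := v ∘ Sum.inl with hz
    set e := v ∘ Sum.inr with he
    have hve : v = Sum.elim z e := (Sum.elim_comp_inl_inr v).symm
    rw [hve, sumElim_dotProduct_sumElim]
    have h1 : z ⬝ᵥ S *ᵥ e = (Sᵀ *ᵥ z) ⬝ᵥ e := by
      rw [Matrix.dotProduct_mulVec, Matrix.mulVec_transpose]
    have h2 : e ⬝ᵥ Sᵀ *ᵥ z = (Sᵀ *ᵥ z) ⬝ᵥ e := dotProduct_comm _ _
    have h3 : z ⬝ᵥ (S * Sᵀ) *ᵥ z = (Sᵀ *ᵥ z) ⬝ᵥ (Sᵀ *ᵥ z) := by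
      rw [← Matrix.mulVec_mulVec, Matrix.dotProduct_mulVec, Matrix.mulVec_transpose]
    have h4 : (0 : ℝ) ≤ ((2 / γ) • (Sᵀ *ᵥ z) - e) ⬝ᵥ ((2 / γ) • (Sᵀ *ᵥ z) - e) :=
      Finset.sum_nonneg fun i _ => mul_self_nonneg _
    rw [sub_dotProduct, dotProduct_sub, dotProduct_sub, smul_dotProduct, dotProduct_smul,
      dotProduct_smul, smul_dotProduct, dotProduct_comm e, smul_eq_mul, smul_eq_mul, smul_eq_mul] at h4
    have h4' : 2 * ((Sᵀ *ᵥ z) ⬝ᵥ e) ≤ (2 / γ) * ((Sᵀ *ᵥ z) ⬝ᵥ (Sᵀ *ᵥ z)) + γ / 2 * (e ⬝ᵥ e) := by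
      have h5 := mul_nonneg (half_pos hγ0).le h4
      have h6 : γ / 2 * (2 / γ * (2 / γ * (Sᵀ *ᵥ z ⬝ᵥ Sᵀ *ᵥ z)) - 2 / γ * (Sᵀ *ᵥ z ⬝ᵥ e)
          - (2 / γ * (Sᵀ *ᵥ z ⬝ᵥ e) - e ⬝ᵥ e))
          = (2 / γ) * ((Sᵀ *ᵥ z) ⬝ᵥ (Sᵀ *ᵥ z)) + γ / 2 * (e ⬝ᵥ e) - 2 * ((Sᵀ *ᵥ z) ⬝ᵥ e) := by
        field_simp
        ring
      linarith
    have h7 : z ⬝ᵥ (C + (1 / γ) • (D + (2 : ℝ) • (S * Sᵀ))) *ᵥ z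
        = z ⬝ᵥ (C + (1 / γ) • D) *ᵥ z + 2 / γ * ((Sᵀ *ᵥ z) ⬝ᵥ (Sᵀ *ᵥ z)) := by
      rw [smul_add, ← add_assoc, Matrix.add_mulVec _ ((1 / γ) • (2 : ℝ) • _), dotProduct_add, smul_smul,
        Matrix.smul_mulVec, dotProduct_smul, h3, smul_eq_mul]
      ring
    have h8 : e ⬝ᵥ (-(γ • (1 : Matrix (Fin na) (Fin na) ℝ))) *ᵥ e = - (γ * (e ⬝ᵥ e)) := by
      rw [Matrix.neg_mulVec, Matrix.smul_mulVec, Matrix.one_mulVec, dotProduct_neg, dotProduct_smul,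
        smul_eq_mul]
    have hee : 0 ≤ e ⬝ᵥ e := Finset.sum_nonneg fun i _ => mul_self_nonneg _
    rw [dotProduct_add, dotProduct_add, h1, h2, h8]
    by_cases hz0 : z = 0
    · have he0 : e ≠ 0 := by
        intro he0
        apply hv
        rw [hve, hz0, he0]
        ext (i | i) <;> rfl
      have hee' : 0 < e ⬝ᵥ e := lt_of_le_of_ne hee (Ne.symm (by simpa using he0))
      rw [hz0]
      simp only [Matrix.mulVec_zero, dotProduct_zero, zero_dotProduct, zero_add, add_zero]
      nlinarith [mul_pos hγ0 hee']
    · have h9 : z ⬝ᵥ (C + (1 / γ) • (D + (2 : ℝ) • (S * Sᵀ))) *ᵥ z < 0 := hγ z hz0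
      rw [h7] at h9
      nlinarith [mul_nonneg hγ0.le hee]

end LMI

/-! ### Vector-valued integrals and integration by parts. -/

section Calculus

variable {m n p : Type} [Fintype m] [Fintype n] [Fintype p]

lemma intervalIntegrable_pi_iff {f : ℝ → n → ℝ} {a b : ℝ} :
    IntervalIntegrable f volume a b ↔ ∀ i, IntervalIntegrable (fun t => f t i) volume a b := by
  simp only [intervalIntegrable_iff, IntegrableOn]
  exact integrable_pi_iff

lemma intervalIntegral_apply {f : ℝ → n → ℝ} {a b : ℝ} (hf : IntervalIntegrable f volume a b)
    (i : n) : (∫ t in a..b, f t) i = ∫ t in a..b, f t i :=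
  ((ContinuousLinearMap.proj (R := ℝ) (φ := fun _ : n => ℝ) i).intervalIntegral_comp_comm hf).symm

lemma _root_.IntervalIntegrable.matrix_mulVec {M : ℝ → Matrix m n ℝ} (hM : Continuous M) {g : ℝ → n → ℝ}
    {a b : ℝ} (hg : IntervalIntegrable g volume a b) :
    IntervalIntegrable (fun t => M t *ᵥ g t) volume a b := by
  rw [intervalIntegrable_pi_iff] at hg ⊢
  intro i
  simp only [Matrix.mulVec, dotProduct]
  have h := IntervalIntegrable.sum (μ := volume) (a := a) (b := b) Finset.univ
    (f := fun j t => M t i j * g t j)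
    fun j _ => (hg j).continuousOn_mul (hM.matrix_elem i j).continuousOn
  refine h.congr_ae (Filter.Eventually.of_forall fun t => ?_)
  simp

lemma mulVec_intervalIntegral (M : Matrix m n ℝ) {g : ℝ → n → ℝ} {a b : ℝ}
    (hg : IntervalIntegrable g volume a b) :
    M *ᵥ ∫ t in a..b, g t = ∫ t in a..b, M *ᵥ g t :=
  ((LinearMap.toContinuousLinearMap M.mulVecLin).intervalIntegral_comp_comm hg).symm

omit [Fintype m] in
lemma _root_.HasDerivAt.matrix_mulVec {M : ℝ → Matrix m n ℝ} {M' : Matrix m n ℝ} {g : ℝ → n → ℝ} {g' : n → ℝ}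
    {t : ℝ} (hM : ∀ i j, HasDerivAt (fun s => M s i j) (M' i j) t) (hg : HasDerivAt g g' t) :
    HasDerivAt (fun s => M s *ᵥ g s) (M' *ᵥ g t + M t *ᵥ g') t := by
  rw [hasDerivAt_pi] at hg ⊢
  intro i
  have := HasDerivAt.fun_sum (u := Finset.univ) fun j _ => (hM i j).mul (hg j)
  refine this.congr_deriv ?_
  simp [Matrix.mulVec, dotProduct, Finset.sum_add_distrib]

omit [Fintype m] [Fintype p] in
lemma hasDerivAt_matrix_mul_apply {M : ℝ → Matrix m n ℝ} {M' : Matrix m n ℝ} {L : ℝ → Matrix n p ℝ}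
    {L' : Matrix n p ℝ} {t : ℝ} (hM : ∀ i j, HasDerivAt (fun s => M s i j) (M' i j) t)
    (hL : ∀ i j, HasDerivAt (fun s => L s i j) (L' i j) t) (i : m) (j : p) :
    HasDerivAt (fun s => (M s * L s) i j) ((M' * L t + M t * L') i j) t := by
  simp only [Matrix.mul_apply]
  have := HasDerivAt.fun_sum (u := Finset.univ) fun k _ => (hM i k).mul (hL k j)
  refine this.congr_deriv ?_
  simp [Matrix.add_apply, Matrix.mul_apply, Finset.sum_add_distrib]

/-- Integration by parts, for a continuously differentiable factor and a primitive. -/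
lemma mul_primitive_eq_integral {M M' : ℝ → ℝ} (hM : ∀ t, HasDerivAt M (M' t) t)
    (hM' : Continuous M') {g : ℝ → ℝ} {t : ℝ} (hg : IntervalIntegrable g volume 0 t) :
    M t * ∫ s in 0..t, g s = ∫ s in 0..t, (M' s * (∫ r in 0..s, g r) + M s * g s) := by
  have hC1 : ContDiff ℝ 1 M := contDiff_one_iff_deriv.2
    ⟨fun s => (hM s).differentiableAt, by rwa [funext fun s => (hM s).deriv]⟩
  -- The primitive of a merely integrable `g` is differentiable only almost everywhere, hence the
  -- absolutely continuous version.
  have h := AbsolutelyContinuousOnInterval.integral_deriv_mul_eq_sub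
    (hC1.contDiffOn.absolutelyContinuousOnInterval (a := 0) (b := t))
    (hg.absolutelyContinuousOnInterval_intervalIntegral Set.left_mem_uIcc)
  rw [intervalIntegral.integral_same, mul_zero, sub_zero] at h
  rw [← h]
  refine intervalIntegral.integral_congr_ae ?_
  filter_upwards [hg.ae_hasDerivAt_integral] with s hs hst
  rw [(hM s).deriv, (hs (Set.uIoc_subset_uIcc hst) 0 Set.left_mem_uIcc).deriv]

lemma mulVec_primitive_eq_integral {M M' : ℝ → Matrix m n ℝ}
    (hM : ∀ i j t, HasDerivAt (fun t => M t i j) (M' t i j) t) (hMc : Continuous M)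
    (hM' : Continuous M') {g : ℝ → n → ℝ} {t : ℝ} (hg : IntervalIntegrable g volume 0 t) :
    M t *ᵥ ∫ s in 0..t, g s = ∫ s in 0..t, (M' s *ᵥ (∫ r in 0..s, g r) + M s *ᵥ g s) := by
  have hprim : IntervalIntegrable (fun s => ∫ r in 0..s, g r) volume 0 t :=
    (intervalIntegral.continuousOn_primitive_interval' hg Set.left_mem_uIcc).intervalIntegrable
  have hgi := intervalIntegrable_pi_iff.1 hg
  have hpi := intervalIntegrable_pi_iff.1 hprim
  ext i
  rw [intervalIntegral_apply ((hprim.matrix_mulVec hM').add (hg.matrix_mulVec hMc))]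
  simp only [Pi.add_apply, Matrix.mulVec, dotProduct, ← Finset.sum_add_distrib]
  rw [intervalIntegral.integral_finsetSum]
  · refine Finset.sum_congr rfl fun j _ => ?_
    rw [intervalIntegral_apply hg, mul_primitive_eq_integral (hM i j) (hM'.matrix_elem i j) (hgi j)]
    refine intervalIntegral.integral_congr fun s hs => ?_
    rw [intervalIntegral_apply (hg.mono_set (Set.uIcc_subset_uIcc_left hs))]
  · intro j _
    exact ((hpi j).continuousOn_mul (hM'.matrix_elem i j).continuousOn).add
      ((hgi j).continuousOn_mul (hMc.matrix_elem i j).continuousOn)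

end Calculus

/-! ### The plant: continuity, state feedback, variation of constants. -/

section Plant

variable {ns na : ℕ} (A : Matrix (Fin ns) (Fin ns) ℝ) (B : Matrix (Fin ns) (Fin na) ℝ)

lemma plant_def (u : Signal (Fin na)) (t : ℝ) :
    plant A B u t = ∫ s in (0 : ℝ)..t, propagator A (t - s) *ᵥ (B *ᵥ u s) := rfl

lemma continuous_propagator_neg : Continuous fun s => propagator A (-s) :=
  (continuous_propagator A).comp continuous_neg

lemma hasDerivAt_propagator_neg_apply (t : ℝ) (i j : Fin ns) :
    HasDerivAt (fun t => propagator A (-t) i j) ((-(propagator A (-t) * A)) i j) t := by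
  have := (hasDerivAt_propagator_apply A (-t) i j).comp t (hasDerivAt_neg t)
  rw [← commute_propagator]
  exact this.congr_deriv (by simp)

variable {A B} {u : Signal (Fin na)} {t : ℝ}

lemma intervalIntegrable_plant_integrand (hu : IntervalIntegrable u volume 0 t) :
    IntervalIntegrable (fun s => propagator A (-s) *ᵥ (B *ᵥ u s)) volume 0 t :=
  (hu.matrix_mulVec (M := fun _ => B) continuous_const).matrix_mulVec (continuous_propagator_neg A)

/-- Moves `t` out of the integrand, so that continuity and the product rule become available. -/
lemma plant_eq (hu : IntervalIntegrable u volume 0 t) :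
    plant A B u t = propagator A t *ᵥ ∫ s in 0..t, propagator A (-s) *ᵥ (B *ᵥ u s) := by
  rw [plant_def, mulVec_intervalIntegral _ (intervalIntegrable_plant_integrand hu)]
  refine intervalIntegral.integral_congr fun s _ => ?_
  rw [sub_eq_add_neg, propagator_add, ← Matrix.mulVec_mulVec]

lemma plant_congr {v : Signal (Fin na)} (ht : 0 ≤ t)
    (h : u =ᵐ[volume.restrict (Set.Icc 0 t)] v) : plant A B u t = plant A B v t := by
  refine intervalIntegral.integral_congr_ae ?_
  rw [Set.uIoc_of_le ht]
  have := (ae_restrict_iff' measurableSet_Icc).1 h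
  filter_upwards [this] with s hs hst
  rw [hs (Set.Ioc_subset_Icc_self hst)]

lemma continuousOn_plant (hu : IntervalIntegrable u volume 0 t) :
    ContinuousOn (plant A B u) (Set.uIcc 0 t) := by
  have h1 : ContinuousOn (fun s => propagator A s *ᵥ ∫ r in 0..s, propagator A (-r) *ᵥ (B *ᵥ u r))
      (Set.uIcc 0 t) := by
    have h2 := intervalIntegral.continuousOn_primitive_interval'
      (intervalIntegrable_plant_integrand (A := A) (B := B) hu) Set.left_mem_uIcc
    rw [continuousOn_iff_continuous_domRestrict] at h2 ⊢
    exact ((continuous_propagator A).comp continuous_subtype_val).matrix_mulVec h2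
  refine h1.congr fun s hs => ?_
  exact plant_eq (hu.mono_set (Set.uIcc_subset_uIcc_left hs))

/-- State feedback: the response of `ẋ = (A + B K) x + B e` is the response of `ẋ = A x + B u` to
`u = e + K x`. -/
theorem plant_feedback (K : Matrix (Fin na) (Fin ns) ℝ) (hu : IntervalIntegrable u volume 0 t) :
    plant (A + B * K) B u t = plant A B (fun s => u s + K *ᵥ plant (A + B * K) B u s) t := by
  set A' := A + B * K with hA'
  have hK : IntervalIntegrable (fun s => K *ᵥ plant A' B u s) volume 0 t :=
    ((continuousOn_plant hu).intervalIntegrable).matrix_mulVec (M := fun _ => K) continuous_const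
  rw [plant_eq (hu.add hK), plant_eq hu]
  -- The derivative of `e^{-sA} e^{sA'}` is `e^{-sA} (B K) e^{sA'}`, since `A' - A = B K`.
  -- Integration by parts against the primitive of `e^{-sA'} B u` produces the feedback term.
  have h1 := mulVec_primitive_eq_integral (M := fun s => propagator A (-s) * propagator A' s)
    (M' := fun s => propagator A (-s) * (B * K) * propagator A' s) (g := fun s =>
      propagator A' (-s) *ᵥ (B *ᵥ u s)) (t := t) (by
        intro i j s
        refine (hasDerivAt_matrix_mul_apply (hasDerivAt_propagator_neg_apply A s)
          (hasDerivAt_propagator_apply A' s) i j).congr_deriv ?_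
        refine congrFun (congrFun ?_ i) j
        rw [hA']
        simp only [Matrix.mul_assoc, Matrix.add_mul, Matrix.mul_add, Matrix.neg_mul]
        rw [neg_add_cancel_left])
    ((continuous_propagator_neg A).matrix_mul (continuous_propagator A'))
    (((continuous_propagator_neg A).matrix_mul continuous_const).matrix_mul (continuous_propagator A'))
    (intervalIntegrable_plant_integrand hu)
  have h2 := congrArg (fun v => propagator A t *ᵥ v) h1
  rw [Matrix.mulVec_mulVec, ← Matrix.mul_assoc, propagator_mul_neg, Matrix.one_mul] at h2
  rw [h2]
  congr 1
  refine intervalIntegral.integral_congr fun s hs => ?_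
  rw [plant_eq (hu.mono_set (Set.uIcc_subset_uIcc_left hs)), Matrix.mulVec_add, Matrix.mulVec_add,
    add_comm]
  simp only [Matrix.mulVec_mulVec, Matrix.mul_assoc]
  rw [← Matrix.mul_assoc (propagator A' s), propagator_mul_neg, Matrix.one_mul]

/-- Variation of constants against a smooth reference trajectory on `[a, t]`. -/
theorem plant_eq_of_trajectory {a : ℝ} (ha : 0 ≤ a) (hat : a ≤ t)
    (hu : IntervalIntegrable u volume 0 t) {y : ℝ → Fin ns → ℝ} {w : ℝ → Fin na → ℝ}
    (hw : Continuous w) (hy : ∀ s, HasDerivAt y (A *ᵥ y s + B *ᵥ w s) s)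
    (huw : ∀ s ∈ Set.Ioo a t, u s = w s) :
    plant A B u t = y t + propagator A (t - a) *ᵥ (plant A B u a - y a) := by
  have hua : IntervalIntegrable u volume 0 a :=
    hu.mono_set (Set.uIcc_subset_uIcc_left (by rw [Set.uIcc_of_le (ha.trans hat)]; exact ⟨ha, hat⟩))
  have hi := intervalIntegrable_plant_integrand (A := A) (B := B) hu
  have hia := intervalIntegrable_plant_integrand (A := A) (B := B) hua
  have hFTC : ∫ s in a..t, propagator A (-s) *ᵥ (B *ᵥ u s)
      = propagator A (-t) *ᵥ y t - propagator A (-a) *ᵥ y a := by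
    have hd : ∀ s, HasDerivAt (fun s => propagator A (-s) *ᵥ y s)
        (propagator A (-s) *ᵥ (B *ᵥ w s)) s := by
      intro s
      refine ((HasDerivAt.matrix_mulVec (hasDerivAt_propagator_neg_apply A s) (hy s))).congr_deriv ?_
      rw [Matrix.mulVec_add, Matrix.neg_mulVec, ← Matrix.mulVec_mulVec]
      abel
    rw [← intervalIntegral.integral_eq_sub_of_hasDerivAt (fun s _ => hd s)]
    · refine intervalIntegral.integral_congr_ae ?_
      rw [Set.uIoc_of_le hat]
      -- The right endpoint is excluded because the input may switch there.
      have : ∀ᵐ s : ℝ, s ≠ t := by simp [ae_iff]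
      filter_upwards [this] with s hs hst
      rw [huw s ⟨hst.1, lt_of_le_of_ne hst.2 hs⟩]
    · exact ((continuous_propagator_neg A).matrix_mulVec
        (continuous_const.matrix_mulVec hw)).intervalIntegrable _ _
  rw [plant_eq hu, plant_eq hua, ← intervalIntegral.integral_add_adjacent_intervals hia
    (hia.symm.trans hi), hFTC, Matrix.mulVec_sub, Matrix.mulVec_add, Matrix.mulVec_sub]
  simp only [Matrix.mulVec_mulVec, ← propagator_add, add_neg_cancel, propagator_zero,
    Matrix.one_mulVec, sub_add_cancel, ← sub_eq_add_neg]
  abel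

end Plant

/-! ### Partitions of the half line into blocks. -/

section Partition

/-- A partition of `[0, ∞)` into the consecutive blocks `[σ m, σ (m + 1))`. -/
structure IsPartition (σ : ℕ → ℝ) : Prop where
  zero : σ 0 = 0
  strictMono : StrictMono σ
  tendsto : Tendsto σ atTop atTop

/-- The `m`-th block of a partition. -/
def block (σ : ℕ → ℝ) (m : ℕ) : Set ℝ := Set.Ico (σ m) (σ (m + 1))

/-- The index of the block that contains `t`. -/
noncomputable def blockIndex (σ : ℕ → ℝ) (t : ℝ) : ℕ := sInf {m | t < σ (m + 1)}

variable {σ : ℕ → ℝ} {t : ℝ} {m : ℕ}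

lemma measurableSet_block : MeasurableSet (block σ m) := measurableSet_Ico

lemma IsPartition.nonneg (hσ : IsPartition σ) (m : ℕ) : 0 ≤ σ m :=
  hσ.zero ▸ hσ.strictMono.monotone (Nat.zero_le m)

lemma IsPartition.lt_succ (hσ : IsPartition σ) (m : ℕ) : σ m < σ (m + 1) :=
  hσ.strictMono (Nat.lt_succ_self m)

lemma IsPartition.lt_blockIndex (hσ : IsPartition σ) (t : ℝ) : t < σ (blockIndex σ t + 1) := by
  have hne : {m | t < σ (m + 1)}.Nonempty := by
    obtain ⟨m, hm⟩ := ((hσ.tendsto.comp (tendsto_add_atTop_nat 1)).eventually_gt_atTop t).exists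
    exact ⟨m, hm⟩
  exact Nat.sInf_mem hne

lemma IsPartition.blockIndex_le (hσ : IsPartition σ) (ht : 0 ≤ t) : σ (blockIndex σ t) ≤ t := by
  by_contra! h
  rcases hm : blockIndex σ t with _ | m
  · rw [hm, hσ.zero] at h
    linarith
  · rw [hm] at h
    have : blockIndex σ t ≤ m := Nat.sInf_le h
    omega

lemma IsPartition.blockIndex_eq_iff (hσ : IsPartition σ) (ht : 0 ≤ t) :
    blockIndex σ t = m ↔ t ∈ block σ m := by
  constructor
  · rintro rfl
    exact ⟨hσ.blockIndex_le ht, hσ.lt_blockIndex t⟩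
  · rintro ⟨h1, h2⟩
    refine le_antisymm (Nat.sInf_le h2) ?_
    by_contra! h
    have := hσ.strictMono.monotone (Nat.succ_le_of_lt h)
    exact absurd (hσ.lt_blockIndex t) (not_lt.2 (this.trans h1))

lemma IsPartition.block_subset_Ici (hσ : IsPartition σ) (m : ℕ) : block σ m ⊆ Set.Ici 0 :=
  fun _ ht => (hσ.nonneg m).trans ht.1

lemma IsPartition.block_subset_Icc (m : ℕ) (hσ : IsPartition σ) :
    block σ m ⊆ Set.Icc 0 (σ (m + 1)) :=
  fun _ ht => ⟨(hσ.nonneg m).trans ht.1, ht.2.le⟩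

lemma IsPartition.blockIndex_of_mem (hσ : IsPartition σ) (h : t ∈ block σ m) :
    blockIndex σ t = m :=
  (hσ.blockIndex_eq_iff (hσ.block_subset_Ici m h)).2 h

lemma IsPartition.measurable_blockIndex (hσ : IsPartition σ) : Measurable (blockIndex σ) := by
  refine measurable_to_countable' fun m => ?_
  -- Negative times get index `0`.
  have h : blockIndex σ ⁻¹' {m} = (if m = 0 then Set.Iio 0 else ∅) ∪ block σ m := by
    ext t
    rcases lt_or_ge t 0 with ht | ht
    · have h0 : blockIndex σ t = 0 :=
        Nat.le_zero.1 (Nat.sInf_le (ht.trans_le (hσ.nonneg _)))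
      have h1 : t ∉ block σ m := fun h => absurd (hσ.block_subset_Ici m h) (not_le.2 ht)
      by_cases hm : m = 0
      · simp [h0, hm, ht]
      · simp [h0, hm, h1, Ne.symm hm]
    · rw [Set.mem_preimage, Set.mem_singleton_iff, hσ.blockIndex_eq_iff ht]
      by_cases hm : m = 0 <;> simp [hm, ht]
  rw [h]
  refine MeasurableSet.union ?_ measurableSet_block
  split_ifs
  · exact measurableSet_Iio
  · exact MeasurableSet.empty

lemma IsPartition.lintegral_eq_tsum (hσ : IsPartition σ) (f : ℝ → ENNReal) :
    ∫⁻ t in Set.Ici 0, f t = ∑' m, ∫⁻ t in block σ m, f t := by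
  rw [← lintegral_iUnion (fun m => measurableSet_block)]
  · congr 2
    ext t
    simp only [Set.mem_iUnion]
    exact ⟨fun ht => ⟨_, (hσ.blockIndex_eq_iff ht).1 rfl⟩, fun ⟨m, hm⟩ => hσ.block_subset_Ici m hm⟩
  · intro a b hab
    rw [Function.onFun, Set.disjoint_left]
    intro t ha hb
    exact hab ((hσ.blockIndex_of_mem ha).symm.trans (hσ.blockIndex_of_mem hb))

end Partition

/-! ### Closure properties of `L₂` and `L₂ₑ` signals. -/

section Signals

variable {ι : Type} {x : Signal ι}

lemma MemL2.memL2e (hx : MemL2 x) : MemL2e x := fun i _ _ =>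
  (hx i).mono_measure (Measure.restrict_mono Set.Icc_subset_Ici_self le_rfl)

lemma MemL2e.intervalIntegrable [Fintype ι] (hx : MemL2e x) {t : ℝ} (ht : 0 ≤ t) :
    IntervalIntegrable x volume 0 t := by
  rw [intervalIntegrable_pi_iff]
  intro i
  rw [intervalIntegrable_iff_integrableOn_Icc_of_le ht]
  exact (hx i t ht).integrable one_le_two

lemma MemL2e.memLp_block {σ : ℕ → ℝ} (hσ : IsPartition σ) (hx : MemL2e x) (m : ℕ) (i : ι) :
    MemLp (fun t => x t i) 2 (volume.restrict (block σ m)) :=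
  (hx i _ (hσ.nonneg (m + 1))).mono_measure (Measure.restrict_mono (hσ.block_subset_Icc m) le_rfl)

lemma MemL2e.aestronglyMeasurable (hx : MemL2e x) (i : ι) :
    AEStronglyMeasurable (fun t => x t i) (volume.restrict (Set.Ici 0)) := by
  have h : Set.Ici (0 : ℝ) = ⋃ n : ℕ, Set.Icc 0 (n : ℝ) := by
    ext t
    simp only [Set.mem_Ici, Set.mem_iUnion, Set.mem_Icc, exists_and_left]
    exact ⟨fun h => ⟨h, exists_nat_ge t⟩, fun h => h.1⟩
  rw [h, aestronglyMeasurable_iUnion_iff]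
  exact fun n => (hx i n (Nat.cast_nonneg n)).1

lemma ContinuousOn.memL2e [Fintype ι] (hx : ∀ t, 0 ≤ t → ContinuousOn x (Set.Icc 0 t)) :
    MemL2e x := by
  intro i t ht
  have hc : ContinuousOn (fun s => x s i) (Set.Icc 0 t) := (continuous_apply i).comp_continuousOn (hx t ht)
  obtain ⟨C, hC⟩ := isCompact_Icc.exists_bound_of_continuousOn hc
  exact MemLp.of_bound (hc.aestronglyMeasurable measurableSet_Icc) C
    ((ae_restrict_iff' measurableSet_Icc).2 (Eventually.of_forall hC))

lemma MemL2e.plant {ns na : ℕ} {A : Matrix (Fin ns) (Fin ns) ℝ} {B : Matrix (Fin ns) (Fin na) ℝ}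
    {u : Signal (Fin na)} (hu : MemL2e u) : MemL2e (plant A B u) :=
  ContinuousOn.memL2e fun t ht => by
    have := continuousOn_plant (A := A) (B := B) (hu.intervalIntegrable ht)
    rwa [Set.uIcc_of_le ht] at this

lemma MemL2e.add {y : Signal ι} (hx : MemL2e x) (hy : MemL2e y) : MemL2e (fun t => x t + y t) :=
  fun i T hT => (hx i T hT).add (hy i T hT)

lemma MemL2e.mulVec {κ : Type} [Fintype ι] (hx : MemL2e x) (M : Matrix κ ι ℝ) :
    MemL2e (fun t => M *ᵥ x t) := by
  intro i T hT
  simp only [Matrix.mulVec, dotProduct]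
  exact memLp_finsetSum Finset.univ fun j _ => (hx j T hT).const_mul (M i j)

lemma MemL2.add {y : Signal ι} (hx : MemL2 x) (hy : MemL2 y) : MemL2 (fun t => x t + y t) :=
  fun i => (hx i).add (hy i)

lemma MemL2.mulVec {κ : Type} [Fintype ι] (hx : MemL2 x) (M : Matrix κ ι ℝ) :
    MemL2 (fun t => M *ᵥ x t) := by
  intro i
  simp only [Matrix.mulVec, dotProduct]
  exact memLp_finsetSum Finset.univ fun j _ => (hx j).const_mul (M i j)

lemma energy_eq_sum [Fintype ι] (hx : MemL2 x) :
    energy x = ∑ i, ∫ t in Set.Ici (0 : ℝ), x t i ^ 2 :=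
  integral_finsetSum _ fun i _ => (hx i).integrable_sq

end Signals

/-! ### The block-delayed operator and its membership in the sector class. -/

section MemoryOperator

variable {ns na : ℕ}

/-- Correlation of `x` with the template `ξ` over each block, componentwise. -/
noncomputable def memCoeff (σ : ℕ → ℝ) (ξ x : Signal (Fin ns)) (m : ℕ) (j : Fin ns) : ℝ :=
  (∫ t in block σ m, ξ t j * x t j) / ∫ t in block σ m, ξ t j ^ 2

/-- The template `η`, scaled on each block by the coefficients of the preceding block. -/
noncomputable def replay (σ : ℕ → ℝ) (η : Signal (Fin na × Fin ns)) (k : ℕ → Fin ns → ℝ) :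
    Signal (Fin na × Fin ns) := fun t p =>
  (if blockIndex σ t = 0 then 0 else k (blockIndex σ t - 1) p.2) * η t p

/-- The static gain at the centre of the sector, plus the block-delayed finite-rank operator that
recognizes the template `ξ` and replays the template `η` one block later. -/
noncomputable def sectorOp (lo hi : Fin na → Fin ns → ℝ) (σ : ℕ → ℝ) (ξ : Signal (Fin ns))
    (η : Signal (Fin na × Fin ns)) (x : Signal (Fin ns)) : Signal (Fin na × Fin ns) :=
  fun t p => ctr lo hi p.1 p.2 * x t p.2 + replay σ η (memCoeff σ ξ x) t p

/-- Templates for which the block-delayed operator respects the sector radii. -/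
structure IsTemplate (lo hi : Fin na → Fin ns → ℝ) (σ : ℕ → ℝ) (ξ : Signal (Fin ns))
    (η : Signal (Fin na × Fin ns)) : Prop where
  partition : IsPartition σ
  memL2e_left : MemL2e ξ
  memL2e_right : MemL2e η
  le : ∀ m i j, ∫ t in block σ (m + 1), η t (i, j) ^ 2
    ≤ rad lo hi i j ^ 2 * ∫ t in block σ m, ξ t j ^ 2

variable {lo hi : Fin na → Fin ns → ℝ} {σ : ℕ → ℝ} {ξ : Signal (Fin ns)}
  {η : Signal (Fin na × Fin ns)}

lemma replay_of_mem_block_zero (hσ : IsPartition σ) (k : ℕ → Fin ns → ℝ) {t : ℝ}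
    (ht : t ∈ block σ 0) (p : Fin na × Fin ns) : replay σ η k t p = 0 := by
  simp [replay, hσ.blockIndex_of_mem ht]

lemma replay_of_mem_block_succ (hσ : IsPartition σ) (k : ℕ → Fin ns → ℝ) {t : ℝ} {m : ℕ}
    (ht : t ∈ block σ (m + 1)) (p : Fin na × Fin ns) : replay σ η k t p = k m p.2 * η t p := by
  simp [replay, hσ.blockIndex_of_mem ht]

/-- The coefficient of block `m` is used only from `σ (m + 1)` on, when that block is over.
Causality and well-posedness both rest on this delay. -/
lemma replay_congr (hσ : IsPartition σ) {k k' : ℕ → Fin ns → ℝ} {t : ℝ} (ht : 0 ≤ t)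
    (h : ∀ m, σ (m + 1) ≤ t → k m = k' m) : replay σ η k t = replay σ η k' t := by
  ext p
  simp only [replay]
  split_ifs with h0
  · rfl
  · obtain ⟨m, hm⟩ := Nat.exists_eq_succ_of_ne_zero h0
    rw [hm, Nat.succ_sub_one, h m]
    have := hσ.blockIndex_le ht
    rwa [hm] at this

lemma memCoeff_congr (hσ : IsPartition σ) {x y : Signal (Fin ns)} {m : ℕ}
    (h : x =ᵐ[volume.restrict (Set.Icc 0 (σ (m + 1)))] y) : memCoeff σ ξ x m = memCoeff σ ξ y m := by
  ext j
  simp only [memCoeff]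
  congr 1
  refine integral_congr_ae ?_
  filter_upwards [ae_restrict_of_ae_restrict_of_subset (hσ.block_subset_Icc m) h] with t ht
  rw [ht]

lemma memCoeff_add (hσ : IsPartition σ) (hξ : MemL2e ξ) {x y : Signal (Fin ns)} (hx : MemL2e x)
    (hy : MemL2e y) (m : ℕ) (j : Fin ns) :
    memCoeff σ ξ (fun t => x t + y t) m j = memCoeff σ ξ x m j + memCoeff σ ξ y m j := by
  simp only [memCoeff, Pi.add_apply, mul_add]
  rw [integral_add, add_div]
  · exact (hξ.memLp_block hσ m j).integrable_mul (hx.memLp_block hσ m j)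
  · exact (hξ.memLp_block hσ m j).integrable_mul (hy.memLp_block hσ m j)

lemma aestronglyMeasurable_replay (hσ : IsPartition σ) (hη : MemL2e η) (k : ℕ → Fin ns → ℝ)
    (p : Fin na × Fin ns) :
    AEStronglyMeasurable (fun t => replay σ η k t p) (volume.restrict (Set.Ici 0)) := by
  refine AEStronglyMeasurable.mul ?_ (hη.aestronglyMeasurable p)
  have h : Measurable fun i : ℕ => (if i = 0 then 0 else k (i - 1) p.2 : ℝ) := measurable_of_countable _
  exact (h.comp hσ.measurable_blockIndex).aestronglyMeasurable

lemma memL2e_replay (hσ : IsPartition σ) (hη : MemL2e η) (k : ℕ → Fin ns → ℝ) :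
    MemL2e (replay σ η k) := by
  intro p T hT
  -- Only finitely many coefficients act before `T`; no uniform bound on them is required.
  refine (hη p T hT).of_le_mul (c := ∑ i ∈ Finset.range (blockIndex σ T + 1), |k i p.2|)
    ((aestronglyMeasurable_replay hσ hη k p).mono_measure
      (Measure.restrict_mono Set.Icc_subset_Ici_self le_rfl))
    ((ae_restrict_iff' measurableSet_Icc).2 (Eventually.of_forall fun t ht => ?_))
  rw [replay, norm_mul]
  refine mul_le_mul_of_nonneg_right ?_ (norm_nonneg _)
  split_ifs with h0
  · rw [norm_zero]
    exact Finset.sum_nonneg fun _ _ => abs_nonneg _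
  · refine Finset.single_le_sum (f := fun i => |k i p.2|) (fun _ _ => abs_nonneg _) ?_
    have h1 : σ (blockIndex σ t) < σ (blockIndex σ T + 1) :=
      ((hσ.blockIndex_le ht.1).trans ht.2).trans_lt (hσ.lt_blockIndex T)
    have := hσ.strictMono.lt_iff_lt.1 h1
    rw [Finset.mem_range]
    omega

lemma integral_quadratic {μ : Measure ℝ} {f g : ℝ → ℝ} (hf : MemLp f 2 μ) (hg : MemLp g 2 μ)
    (a b c : ℝ) : ∫ t, (a * f t ^ 2 + b * (f t * g t) + c * g t ^ 2) ∂μ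
      = a * (∫ t, f t ^ 2 ∂μ) + b * (∫ t, f t * g t ∂μ) + c * ∫ t, g t ^ 2 ∂μ := by
  have h1 : Integrable (fun t => a * f t ^ 2) μ := hf.integrable_sq.const_mul a
  have h2 : Integrable (fun t => b * (f t * g t)) μ := (hf.integrable_mul hg).const_mul b
  have h3 : Integrable (fun t => c * g t ^ 2) μ := hg.integrable_sq.const_mul c
  have h12 : Integrable (fun t => a * f t ^ 2 + b * (f t * g t)) μ := h1.add h2
  rw [integral_add h12 h3, integral_add h1 h2, integral_const_mul, integral_const_mul,
    integral_const_mul]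

/-- Bessel's inequality: the coefficient is that of the orthogonal projection of `xⱼ` onto `ξⱼ` over
the block, and the template inequality passes to the next block. -/
lemma IsTemplate.integral_block_le (h : IsTemplate lo hi σ ξ η) {x : Signal (Fin ns)} (hx : MemL2e x)
    (m : ℕ) (i : Fin na) (j : Fin ns) :
    memCoeff σ ξ x m j ^ 2 * ∫ t in block σ (m + 1), η t (i, j) ^ 2
      ≤ rad lo hi i j ^ 2 * ∫ t in block σ m, x t j ^ 2 := by
  have hle := h.le m i j
  set k := memCoeff σ ξ x m j with hk
  set S := ∫ t in block σ m, ξ t j ^ 2 with hS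
  have hxm := hx.memLp_block h.partition m j
  have hξm := h.memL2e_left.memLp_block h.partition m j
  have h1 : 0 ≤ ∫ t in block σ m, (x t j - k * ξ t j) ^ 2 := integral_nonneg fun t => sq_nonneg _
  have h2 : ∫ t in block σ m, (x t j - k * ξ t j) ^ 2
      = (∫ t in block σ m, x t j ^ 2) - 2 * k * (∫ t in block σ m, ξ t j * x t j) + k ^ 2 * S := by
    have := integral_quadratic hξm hxm (k ^ 2) (-2 * k) 1
    rw [show (∫ t in block σ m, (x t j - k * ξ t j) ^ 2) = ∫ t in block σ m,
      (k ^ 2 * ξ t j ^ 2 + -2 * k * (ξ t j * x t j) + 1 * x t j ^ 2) from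
      integral_congr_ae (Eventually.of_forall fun t => by ring), this]
    ring
  have h3 : k * (∫ t in block σ m, ξ t j * x t j) = k ^ 2 * S := by
    -- On a block where `ξⱼ` has no energy, division by zero makes the coefficient `0`.
    by_cases hS0 : S = 0
    · have : k = 0 := by rw [hk, memCoeff, ← hS, hS0, div_zero]
      rw [this]; ring
    · rw [hk, memCoeff, ← hS]
      field_simp
  have h4 : k ^ 2 * S ≤ ∫ t in block σ m, x t j ^ 2 := by nlinarith
  calc _ ≤ k ^ 2 * (rad lo hi i j ^ 2 * S) := mul_le_mul_of_nonneg_left hle (sq_nonneg _)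
    _ = rad lo hi i j ^ 2 * (k ^ 2 * S) := by ring
    _ ≤ _ := mul_le_mul_of_nonneg_left h4 (sq_nonneg _)

/-- Output on block `m + 1` is charged to input on block `m`, and block `0` is silent. With
`lintegral` the estimate needs no integrability and in turn yields it. -/
lemma IsTemplate.lintegral_replay_le (h : IsTemplate lo hi σ ξ η) {x : Signal (Fin ns)}
    (hx : MemL2e x) (i : Fin na) (j : Fin ns) :
    ∫⁻ t in Set.Ici (0 : ℝ), ENNReal.ofReal (replay σ η (memCoeff σ ξ x) t (i, j) ^ 2)
      ≤ ENNReal.ofReal (rad lo hi i j ^ 2) * ∫⁻ t in Set.Ici (0 : ℝ), ENNReal.ofReal (x t j ^ 2) := by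
  rw [h.partition.lintegral_eq_tsum, h.partition.lintegral_eq_tsum, tsum_eq_zero_add' ENNReal.summable,
    ← ENNReal.tsum_mul_left]
  have h0 : ∫⁻ t in block σ 0, ENNReal.ofReal (replay σ η (memCoeff σ ξ x) t (i, j) ^ 2) = 0 := by
    rw [setLIntegral_congr_fun measurableSet_block (g := fun _ => 0) fun t ht => by
      simp [replay_of_mem_block_zero h.partition _ ht]]
    simp
  rw [h0, zero_add]
  refine ENNReal.tsum_le_tsum fun m => ?_
  have hηm := (h.memL2e_right.memLp_block h.partition (m + 1) (i, j)).integrable_sq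
  have hxm := (hx.memLp_block h.partition m j).integrable_sq
  rw [setLIntegral_congr_fun measurableSet_block (g := fun t =>
    ENNReal.ofReal (memCoeff σ ξ x m j ^ 2 * η t (i, j) ^ 2)) fun t ht => by
      simp only [replay_of_mem_block_succ h.partition _ ht, mul_pow],
    ← ofReal_integral_eq_lintegral_ofReal (hηm.const_mul _)
      (Eventually.of_forall fun t => mul_nonneg (sq_nonneg _) (sq_nonneg _)),
    ← ofReal_integral_eq_lintegral_ofReal hxm (Eventually.of_forall fun t => sq_nonneg _),
    ← ENNReal.ofReal_mul (sq_nonneg _), integral_const_mul]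
  exact ENNReal.ofReal_le_ofReal (h.integral_block_le hx m i j)

lemma IsTemplate.memL2_replay (h : IsTemplate lo hi σ ξ η) {x : Signal (Fin ns)} (hx : MemL2 x) :
    MemL2 (replay σ η (memCoeff σ ξ x)) := by
  rintro ⟨i, j⟩
  have hm := aestronglyMeasurable_replay h.partition h.memL2e_right (memCoeff σ ξ x) (i, j)
  rw [memLp_two_iff_integrable_sq hm]
  refine ⟨hm.pow 2, (hasFiniteIntegral_iff_ofReal (Eventually.of_forall fun t => sq_nonneg _)).2 ?_⟩
  refine (h.lintegral_replay_le hx.memL2e i j).trans_lt (ENNReal.mul_lt_top ENNReal.ofReal_lt_top ?_)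
  exact (hasFiniteIntegral_iff_ofReal (Eventually.of_forall fun t => sq_nonneg _)).1
    (hx j).integrable_sq.2

lemma IsTemplate.integral_replay_le (h : IsTemplate lo hi σ ξ η) {x : Signal (Fin ns)} (hx : MemL2 x)
    (i : Fin na) (j : Fin ns) :
    ∫ t in Set.Ici (0 : ℝ), replay σ η (memCoeff σ ξ x) t (i, j) ^ 2
      ≤ rad lo hi i j ^ 2 * ∫ t in Set.Ici (0 : ℝ), x t j ^ 2 := by
  have h1 := h.lintegral_replay_le hx.memL2e i j
  rw [← ofReal_integral_eq_lintegral_ofReal (h.memL2_replay hx (i, j)).integrable_sq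
      (Eventually.of_forall fun t => sq_nonneg _),
    ← ofReal_integral_eq_lintegral_ofReal (hx j).integrable_sq
      (Eventually.of_forall fun t => sq_nonneg _), ← ENNReal.ofReal_mul (sq_nonneg _)] at h1
  exact (ENNReal.ofReal_le_ofReal_iff (mul_nonneg (sq_nonneg _)
    (integral_nonneg fun t => sq_nonneg _))).1 h1

lemma IsTemplate.memL2_sectorOp (h : IsTemplate lo hi σ ξ η) {x : Signal (Fin ns)} (hx : MemL2 x) :
    MemL2 (sectorOp lo hi σ ξ η x) := fun p =>
  ((hx p.2).const_mul _).add (h.memL2_replay hx p)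

theorem IsTemplate.bounded (h : IsTemplate lo hi σ ξ η) : Bounded (sectorOp lo hi σ ξ η) := by
  set D : Fin na × Fin ns → ℝ := fun p => 2 * ctr lo hi p.1 p.2 ^ 2 + 2 * rad lo hi p.1 p.2 ^ 2 with hD
  have hD0 : ∀ p, 0 ≤ D p := fun p => by positivity
  refine ⟨Real.sqrt (∑ p, D p), fun x hx => ⟨h.memL2_sectorOp hx, ?_⟩⟩
  rw [Real.sq_sqrt (Finset.sum_nonneg fun p _ => hD0 p), energy_eq_sum (h.memL2_sectorOp hx),
    Finset.sum_mul]
  refine Finset.sum_le_sum fun p _ => ?_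
  have h1 : ∫ t in Set.Ici (0 : ℝ), sectorOp lo hi σ ξ η x t p ^ 2
      ≤ ∫ t in Set.Ici (0 : ℝ), (2 * ctr lo hi p.1 p.2 ^ 2 * x t p.2 ^ 2
        + 2 * replay σ η (memCoeff σ ξ x) t p ^ 2) := by
    refine integral_mono (h.memL2_sectorOp hx p).integrable_sq
      (((hx p.2).integrable_sq.const_mul _).add ((h.memL2_replay hx p).integrable_sq.const_mul _))
      fun t => ?_
    simp only [sectorOp]
    nlinarith [sq_nonneg (ctr lo hi p.1 p.2 * x t p.2 - replay σ η (memCoeff σ ξ x) t p)]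
  rw [integral_add ((hx p.2).integrable_sq.const_mul _)
    ((h.memL2_replay hx p).integrable_sq.const_mul _), integral_const_mul, integral_const_mul] at h1
  have h2 := h.integral_replay_le hx p.1 p.2
  have h3 : ∫ t in Set.Ici (0 : ℝ), x t p.2 ^ 2 ≤ energy x := by
    rw [energy_eq_sum hx]
    exact Finset.single_le_sum (f := fun j => ∫ t in Set.Ici (0 : ℝ), x t j ^ 2)
      (fun j _ => integral_nonneg fun t => sq_nonneg _) (Finset.mem_univ p.2)
  calc _ ≤ D p * ∫ t in Set.Ici (0 : ℝ), x t p.2 ^ 2 := by simp only [hD]; linarith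
    _ ≤ _ := mul_le_mul_of_nonneg_left h3 (hD0 p)

theorem IsTemplate.sectorBounded (h : IsTemplate lo hi σ ξ η) :
    SectorBounded lo hi (sectorOp lo hi σ ξ η) := by
  intro x hx i j
  have hp := h.memL2_replay hx (i, j)
  have hxj := hx j
  have h1 := h.integral_replay_le hx i j
  set r := replay σ η (memCoeff σ ξ x) with hr
  set c := ctr lo hi i j with hc
  have e1 : inner2 (fun t => x t j) (fun t => x t j) = ∫ t in Set.Ici (0 : ℝ), x t j ^ 2 := by
    simp only [inner2, sq]
  have e2 : inner2 (fun t => sectorOp lo hi σ ξ η x t (i, j)) (fun t => x t j)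
      = c * (∫ t in Set.Ici (0 : ℝ), x t j ^ 2) + ∫ t in Set.Ici (0 : ℝ), r t (i, j) * x t j := by
    have := integral_quadratic hp hxj 0 1 c
    rw [inner2, show (∫ t in Set.Ici (0 : ℝ), sectorOp lo hi σ ξ η x t (i, j) * x t j)
      = ∫ t in Set.Ici (0 : ℝ), (0 * r t (i, j) ^ 2 + 1 * (r t (i, j) * x t j) + c * x t j ^ 2) from
      integral_congr_ae (Eventually.of_forall fun t => by simp only [sectorOp, ← hr, ← hc]; ring), this]
    ring
  have e3 : inner2 (fun t => sectorOp lo hi σ ξ η x t (i, j))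
        (fun t => sectorOp lo hi σ ξ η x t (i, j))
      = c ^ 2 * (∫ t in Set.Ici (0 : ℝ), x t j ^ 2)
        + 2 * c * (∫ t in Set.Ici (0 : ℝ), r t (i, j) * x t j)
        + ∫ t in Set.Ici (0 : ℝ), r t (i, j) ^ 2 := by
    have := integral_quadratic hp hxj 1 (2 * c) (c ^ 2)
    rw [inner2, show (∫ t in Set.Ici (0 : ℝ), sectorOp lo hi σ ξ η x t (i, j)
        * sectorOp lo hi σ ξ η x t (i, j)) = ∫ t in Set.Ici (0 : ℝ),
          (1 * r t (i, j) ^ 2 + 2 * c * (r t (i, j) * x t j) + c ^ 2 * x t j ^ 2) from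
      integral_congr_ae (Eventually.of_forall fun t => by simp only [sectorOp, ← hr, ← hc]; ring), this]
    ring
  rw [sectorForm, e1, e2, e3]
  -- The cross terms cancel and the sector form equals `rad² ‖xⱼ‖² - ‖r‖²`.
  nlinarith

theorem sectorOp_causal (hσ : IsPartition σ) : Causal (sectorOp lo hi σ ξ η) := by
  intro T hT x y _ _ hxy
  filter_upwards [hxy, ae_restrict_mem measurableSet_Icc] with t ht htT
  ext p
  simp only [sectorOp]
  rw [ht, replay_congr hσ htT.1 fun m hm => memCoeff_congr hσ
    (ae_restrict_of_ae_restrict_of_subset (Set.Icc_subset_Icc_right (hm.trans htT.2)) hxy)]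

end MemoryOperator

/-! ### Well-posedness of the loop through strictly causal recursion. -/

/-- A strictly causal map of sequences has exactly one fixed point. -/
lemma exists_fixedPoint_of_strictlyCausal {α : Type*} [Inhabited α] (Φ : (ℕ → α) → ℕ → α)
    (hΦ : ∀ m k k', (∀ i < m, k i = k' i) → Φ k m = Φ k' m) : ∃ k, Φ k = k := by
  have key : ∀ n m, m < n → ∀ r, n ≤ r → (Φ^[r] default) m = (Φ^[n] default) m := by
    intro n
    induction n with
    | zero => intro m hm; omega
    | succ n ih =>
      intro m hm r hr
      obtain ⟨r, rfl⟩ : ∃ r', r = r' + 1 := ⟨r - 1, by omega⟩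
      rw [Function.iterate_succ_apply', Function.iterate_succ_apply']
      exact hΦ m _ _ fun i hi => ih i (by omega) r (by omega)
  -- Entry `m` no longer changes after `m + 1` iterations.
  refine ⟨fun m => (Φ^[m + 1] default) m, funext fun m => ?_⟩
  rw [Function.iterate_succ_apply']
  exact hΦ m _ _ fun i hi => (key (i + 1) i (Nat.lt_succ_self i) m hi).symm

section WellPosedness

variable {ns na : ℕ}

/-- The state feedback gain at the centre of the sector. -/
noncomputable def centerGain (lo hi : Fin na → Fin ns → ℝ) : Matrix (Fin na) (Fin ns) ℝ :=
  Matrix.of fun i j => ctr lo hi i j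

lemma sumMatrix_mulVec (q : Fin na × Fin ns → ℝ) (i : Fin na) :
    (sumMatrix na ns *ᵥ q) i = ∑ j, q (i, j) := by
  simp only [Matrix.mulVec, dotProduct, sumMatrix, Matrix.of_apply, Fintype.sum_prod_type, ite_mul,
    one_mul, zero_mul]
  rw [Finset.sum_comm]
  simp

variable {lo hi : Fin na → Fin ns → ℝ} {σ : ℕ → ℝ} {ξ : Signal (Fin ns)}
  {η : Signal (Fin na × Fin ns)}

/-- Splits the loop into static feedback, absorbed into `A + B K`, and a replay term that acts like
an external input once its coefficients are known. -/
lemma sumMatrix_mulVec_sectorOp (x : Signal (Fin ns)) (t : ℝ) :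
    sumMatrix na ns *ᵥ sectorOp lo hi σ ξ η x t
      = centerGain lo hi *ᵥ x t + sumMatrix na ns *ᵥ replay σ η (memCoeff σ ξ x) t := by
  ext i
  rw [Pi.add_apply, sumMatrix_mulVec, sumMatrix_mulVec]
  simp only [sectorOp, Finset.sum_add_distrib]
  rfl

variable (A : Matrix (Fin ns) (Fin ns) ℝ) (B : Matrix (Fin ns) (Fin na) ℝ)

/-- The input of the centred plant when the loop runs with given replay coefficients. -/
noncomputable def drive (σ : ℕ → ℝ) (η : Signal (Fin na × Fin ns)) (e : Signal (Fin na))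
    (k : ℕ → Fin ns → ℝ) : Signal (Fin na) := fun t => e t + sumMatrix na ns *ᵥ replay σ η k t

lemma drive_congr (hσ : IsPartition σ) {e e' : Signal (Fin na)} {k k' : ℕ → Fin ns → ℝ} {T : ℝ}
    (he : e =ᵐ[volume.restrict (Set.Icc 0 T)] e') (hk : ∀ m, σ (m + 1) ≤ T → k m = k' m) :
    drive σ η e k =ᵐ[volume.restrict (Set.Icc 0 T)] drive σ η e' k' := by
  filter_upwards [he, ae_restrict_mem measurableSet_Icc] with t ht htT
  rw [drive, drive, ht, replay_congr hσ htT.1 fun m hm => hk m (hm.trans htT.2)]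

/-- Strict causality of the coefficient recursion: up to the end of block `m` the replay uses only
coefficients of index below `m`. -/
lemma memCoeff_plant_congr (hσ : IsPartition σ) {e e' : Signal (Fin na)} {k k' : ℕ → Fin ns → ℝ}
    {m : ℕ} (he : e =ᵐ[volume.restrict (Set.Icc 0 (σ (m + 1)))] e') (hk : ∀ i < m, k i = k' i) :
    memCoeff σ ξ (plant A B (drive σ η e k)) m = memCoeff σ ξ (plant A B (drive σ η e' k')) m := by
  ext j
  simp only [memCoeff]
  congr 1
  refine setIntegral_congr_fun measurableSet_block fun t ht => ?_
  have ht0 := hσ.block_subset_Ici m ht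
  rw [plant_congr ht0 (drive_congr (η := η) hσ
    (ae_restrict_of_ae_restrict_of_subset (Set.Icc_subset_Icc_right ht.2.le) he) fun i hi => hk i ?_)]
  have := hσ.strictMono.lt_iff_lt.1 (hi.trans_lt ht.2)
  omega

lemma exists_loopCoeff (hσ : IsPartition σ) (ξ : Signal (Fin ns)) (η : Signal (Fin na × Fin ns))
    (e : Signal (Fin na)) :
    ∃ k, memCoeff σ ξ (plant A B (drive σ η e k)) = k :=
  exists_fixedPoint_of_strictlyCausal (fun k => memCoeff σ ξ (plant A B (drive σ η e k)))
    fun _ _ _ h => memCoeff_plant_congr A B hσ (EventuallyEq.refl _ _) h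

/-- Serves twice: for causal dependence on `e`, and with `e = e'` for uniqueness. -/
lemma loopCoeff_congr (hσ : IsPartition σ) {e e' : Signal (Fin na)} {k k' : ℕ → Fin ns → ℝ} {T : ℝ}
    (he : e =ᵐ[volume.restrict (Set.Icc 0 T)] e')
    (hk : memCoeff σ ξ (plant A B (drive σ η e k)) = k)
    (hk' : memCoeff σ ξ (plant A B (drive σ η e' k')) = k') (m : ℕ) (hm : σ (m + 1) ≤ T) :
    k m = k' m := by
  induction m using Nat.strong_induction_on with
  | _ m ih =>
    rw [← hk, ← hk']
    refine memCoeff_plant_congr A B hσ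
      (ae_restrict_of_ae_restrict_of_subset (Set.Icc_subset_Icc_right hm) he) fun i hi => ih i hi ?_
    exact (hσ.strictMono.monotone (by omega)).trans hm

theorem sectorOp_wellPosed (hσ : IsPartition σ) (hη : MemL2e η) :
    WellPosed A B (sectorOp lo hi σ ξ η) := by
  set K := centerGain lo hi with hK
  choose k hk using exists_loopCoeff (A + B * K) B hσ ξ η
  let d : Signal (Fin na) → Signal (Fin na) := fun e => drive σ η e (k e)
  have hd : ∀ e, MemL2e e → MemL2e (d e) := fun e he =>
    he.add ((memL2e_replay hσ hη (k e)).mulVec _)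
  refine ⟨fun e t => d e t + K *ᵥ plant (A + B * K) B (d e) t, ?_, fun e he => ⟨?_, ?_, ?_⟩⟩
  · intro T hT e e' _ _ hee
    have hdd := drive_congr (η := η) hσ hee (loopCoeff_congr _ _ hσ hee (hk e) (hk e'))
    filter_upwards [hdd, ae_restrict_mem measurableSet_Icc] with t ht htT
    have : d e t = d e' t := ht
    rw [this, plant_congr htT.1
      (ae_restrict_of_ae_restrict_of_subset (Set.Icc_subset_Icc_right htT.2) hdd)]
  · exact (hd e he).add ((hd e he).plant.mulVec K)
  · have hplant : ∀ t, 0 ≤ t →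
        plant A B (fun t => d e t + K *ᵥ plant (A + B * K) B (d e) t) t
          = plant (A + B * K) B (d e) t := fun t ht =>
      (plant_feedback K ((hd e he).intervalIntegrable ht)).symm
    have hcoeff : memCoeff σ ξ (plant A B (fun t => d e t + K *ᵥ plant (A + B * K) B (d e) t))
        = k e := by
      rw [← hk e]
      funext m
      refine memCoeff_congr hσ ?_
      filter_upwards [ae_restrict_mem measurableSet_Icc] with t ht
      exact hplant t ht.1
    filter_upwards [ae_restrict_mem measurableSet_Ici] with t ht
    rw [sumMatrix_mulVec_sectorOp, hcoeff, hplant t ht]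
    simp only [d, drive]
    abel
  · intro u hu hloop
    set x := plant A B u with hx
    have hae : ∀ᵐ t ∂(volume.restrict (Set.Ici (0 : ℝ))),
        u t + (-K) *ᵥ x t = drive σ η e (memCoeff σ ξ x) t := by
      filter_upwards [hloop] with t ht
      rw [sumMatrix_mulVec_sectorOp, ← hx] at ht
      rw [ht, drive, Matrix.neg_mulVec]
      abel
    -- The feedback identity applied to `A + B K` with gain `-K`: any solution is a response of the
    -- centred plant, so its coefficients solve the same recursion.
    have hplant : ∀ t, 0 ≤ t → x t = plant (A + B * K) B (drive σ η e (memCoeff σ ξ x)) t := by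
      intro t ht
      have h1 := plant_feedback (A := A + B * K) (B := B) (-K) (hu.intervalIntegrable ht)
      have h2 : A + B * K + B * (-K) = A := by rw [Matrix.mul_neg, add_neg_cancel_right]
      rw [h2] at h1
      rw [hx, h1]
      exact plant_congr ht (ae_restrict_of_ae_restrict_of_subset Set.Icc_subset_Ici_self hae)
    have hcoeff : memCoeff σ ξ (plant (A + B * K) B (drive σ η e (memCoeff σ ξ x)))
        = memCoeff σ ξ x := by
      funext m
      refine memCoeff_congr hσ ?_
      filter_upwards [ae_restrict_mem measurableSet_Icc] with t ht
      exact (hplant t ht.1).symm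
    have hkx : memCoeff σ ξ x = k e := funext fun m =>
      loopCoeff_congr _ _ hσ (T := σ (m + 1)) (EventuallyEq.refl _ _) hcoeff (hk e) m le_rfl
    filter_upwards [hae, ae_restrict_mem measurableSet_Ici] with t ht ht0
    have h3 : u t = drive σ η e (memCoeff σ ξ x) t + K *ᵥ x t := by
      rw [← ht, Matrix.neg_mulVec]
      abel
    rw [h3, hplant t ht0, hkx]

end WellPosedness

/-! ### An instability criterion and finite-energy estimates. -/

section Instability

lemma energyUpTo_le_energy {ι : Type} [Fintype ι] {x : Signal ι} (hx : MemL2 x) (T : ℝ) :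
    energyUpTo T x ≤ energy x := by
  refine setIntegral_mono_set ?_ (Eventually.of_forall fun t => Finset.sum_nonneg fun i _ => sq_nonneg _)
    (LE.le.eventuallyLE Set.Icc_subset_Ici_self)
  exact integrable_finsetSum _ fun i _ => (hx i).integrable_sq

lemma energyUpTo_add_le {ι : Type} [Fintype ι] {x y : Signal ι} (hx : MemL2e x) (hy : MemL2e y)
    {T : ℝ} (hT : 0 ≤ T) :
    energyUpTo T (fun t => x t + y t) ≤ 2 * energyUpTo T x + 2 * energyUpTo T y := by
  have hxi : Integrable (fun t => ∑ i, x t i ^ 2) (volume.restrict (Set.Icc 0 T)) :=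
    integrable_finsetSum _ fun i _ => (hx i T hT).integrable_sq
  have hyi : Integrable (fun t => ∑ i, y t i ^ 2) (volume.restrict (Set.Icc 0 T)) :=
    integrable_finsetSum _ fun i _ => (hy i T hT).integrable_sq
  rw [energyUpTo, energyUpTo, energyUpTo, ← integral_const_mul, ← integral_const_mul,
    ← integral_add (hxi.const_mul 2) (hyi.const_mul 2)]
  refine integral_mono (integrable_finsetSum _ fun i _ => ((hx.add hy) i T hT).integrable_sq)
    ((hxi.const_mul 2).add (hyi.const_mul 2)) fun t => ?_
  simp only [Finset.mul_sum, ← Finset.sum_add_distrib, Pi.add_apply]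
  refine Finset.sum_le_sum fun i _ => ?_
  nlinarith [sq_nonneg (x t i - y t i)]

variable {ns na : ℕ} {lo hi : Fin na → Fin ns → ℝ} {σ : ℕ → ℝ} {ξ : Signal (Fin ns)}
  {η : Signal (Fin na × Fin ns)} {A : Matrix (Fin ns) (Fin ns) ℝ} {B : Matrix (Fin ns) (Fin na) ℝ}

lemma sectorOp_add (h : IsTemplate lo hi σ ξ η) {x y : Signal (Fin ns)} (hx : MemL2e x)
    (hy : MemL2e y) (t : ℝ) : sectorOp lo hi σ ξ η (fun t => x t + y t) t
      = sectorOp lo hi σ ξ η x t + sectorOp lo hi σ ξ η y t := by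
  ext p
  simp only [sectorOp, replay, Pi.add_apply]
  split_ifs
  · ring
  · rw [memCoeff_add h.partition h.memL2e_left hx hy]
    ring

/-- Instability criterion: a reference trajectory of infinite energy which the loop follows up to
errors of finite energy. -/
theorem IsTemplate.not_ioStable (h : IsTemplate lo hi σ ξ η) {x : Signal (Fin ns)}
    {u : Signal (Fin na)} (hu : MemL2e u)
    (hd : MemL2 (fun t => x t - plant A B u t))
    (hr : MemL2 (fun t => u t - sumMatrix na ns *ᵥ sectorOp lo hi σ ξ η x t))
    (hunb : ∀ C : ℝ, ∃ T, 0 ≤ T ∧ C < energyUpTo T x) :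
    ¬ IOStable A B (sectorOp lo hi σ ξ η) := by
  rintro ⟨γ, hγ⟩
  -- The disturbance for which `u` solves the loop exactly. Additivity of the operator writes it as
  -- the input mismatch plus the image of the state error, both in `L₂`.
  set e : Signal (Fin na) := fun t =>
    u t - sumMatrix na ns *ᵥ sectorOp lo hi σ ξ η (plant A B u) t with he
  have hxd : ∀ t, x t = (x t - plant A B u t) + plant A B u t := fun t => (sub_add_cancel _ _).symm
  have heq : e = fun t => (u t - sumMatrix na ns *ᵥ sectorOp lo hi σ ξ η x t)
      + sumMatrix na ns *ᵥ sectorOp lo hi σ ξ η (fun t => x t - plant A B u t) t := by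
    funext t
    have h1 := sectorOp_add h hd.memL2e (hu.plant (A := A) (B := B)) t
    rw [← funext hxd] at h1
    rw [he, h1, Matrix.mulVec_add]
    beta_reduce
    abel
  have heL2 : MemL2 e := by
    rw [heq]
    exact hr.add ((h.memL2_sectorOp hd).mulVec _)
  obtain ⟨T, hT, hC⟩ := hunb (2 * energy (fun t => x t - plant A B u t) + 2 * (γ ^ 2 * energy e))
  have h1 := hγ e u heL2.memL2e hu (Eventually.of_forall fun t => by simp [he]) T hT
  have h2 := energyUpTo_add_le hd.memL2e (hu.plant (A := A) (B := B)) hT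
  rw [← funext hxd] at h2
  have h3 := energyUpTo_le_energy hd T
  have h4 := mul_le_mul_of_nonneg_left (energyUpTo_le_energy heL2 T) (sq_nonneg γ)
  linarith

/-- A signal that decays exponentially on each block, from square summable initial values, has
finite energy. -/
lemma memL2_of_block_decay {ι : Type} [Fintype ι] {s : ℕ → ℝ} (hs : IsPartition s) {f : Signal ι}
    (hf : MemL2e f) {C a : ℝ} (ha : 0 < a) {b : ℕ → ℝ} (hb : Summable fun l => b l ^ 2)
    (h : ∀ l, ∀ t ∈ block s l, ‖f t‖ ≤ C * Real.exp (-a * (t - s l)) * b l) : MemL2 f := by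
  intro i
  have hm := hf.aestronglyMeasurable i
  rw [memLp_two_iff_integrable_sq hm]
  refine ⟨hm.pow 2, (hasFiniteIntegral_iff_ofReal (Eventually.of_forall fun t => sq_nonneg _)).2 ?_⟩
  rw [hs.lintegral_eq_tsum]
  have hsum : Summable fun l => C ^ 2 * b l ^ 2 * (1 / (2 * a)) := (hb.mul_left _).mul_right _
  refine (ENNReal.tsum_le_tsum (g := fun l => ENNReal.ofReal (C ^ 2 * b l ^ 2 * (1 / (2 * a))))
    fun l => ?_).trans_lt ?_
  · have hd : ∀ t, HasDerivAt (fun t => -(1 / (2 * a)) * Real.exp (-(2 * a) * (t - s l)))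
        (Real.exp (-(2 * a) * (t - s l))) t := by
      intro t
      have := (((hasDerivAt_id t).sub_const (s l)).const_mul (-(2 * a))).exp.const_mul (-(1 / (2 * a)))
      refine this.congr_deriv ?_
      simp only [id]
      field_simp
    have hc : Continuous fun t => Real.exp (-(2 * a) * (t - s l)) := by fun_prop
    -- The bound does not depend on the length of the block.
    have hint : ∫ t in block s l, Real.exp (-(2 * a) * (t - s l)) ≤ 1 / (2 * a) := by
      rw [block, integral_Ico_eq_integral_Ioc, ← intervalIntegral.integral_of_le (hs.lt_succ l).le,
        intervalIntegral.integral_eq_sub_of_hasDerivAt (fun t _ => hd t) (hc.intervalIntegrable _ _),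
        sub_self, mul_zero, Real.exp_zero]
      have : 0 < 1 / (2 * a) * Real.exp (-(2 * a) * (s (l + 1) - s l)) := by positivity
      linarith
    have hi : IntegrableOn (fun t => Real.exp (-(2 * a) * (t - s l))) (block s l) :=
      (hc.integrableOn_Icc (a := s l) (b := s (l + 1))).mono_set Set.Ico_subset_Icc_self
    calc ∫⁻ t in block s l, ENNReal.ofReal (f t i ^ 2)
        ≤ ∫⁻ t in block s l, ENNReal.ofReal (C ^ 2 * b l ^ 2 * Real.exp (-(2 * a) * (t - s l))) := by
          refine setLIntegral_mono' measurableSet_block fun t ht => ENNReal.ofReal_le_ofReal ?_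
          have h1 := (norm_le_pi_norm (f t) i).trans (h l t ht)
          rw [Real.norm_eq_abs] at h1
          have h2 : f t i ^ 2 ≤ (C * Real.exp (-a * (t - s l)) * b l) ^ 2 := by
            rw [← sq_abs (f t i)]
            exact pow_le_pow_left₀ (abs_nonneg _) h1 2
          refine h2.trans (le_of_eq ?_)
          rw [show -(2 * a) * (t - s l) = -a * (t - s l) + -a * (t - s l) by ring, Real.exp_add]
          ring
      _ = ENNReal.ofReal (∫ t in block s l, C ^ 2 * b l ^ 2 * Real.exp (-(2 * a) * (t - s l))) :=
          (ofReal_integral_eq_lintegral_ofReal (hi.const_mul _)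
            (Eventually.of_forall fun t => by positivity)).symm
      _ ≤ _ := by
          rw [integral_const_mul]
          exact ENNReal.ofReal_le_ofReal (mul_le_mul_of_nonneg_left hint (by positivity))
  · rw [← ENNReal.ofReal_tsum_of_nonneg (fun l => by positivity) hsum]
    exact ENNReal.ofReal_lt_top

end Instability

/-! ### Invariance of stationary covariances. -/

section StationaryCovariance

variable {ns N : ℕ} {A : Matrix (Fin ns) (Fin ns) ℝ} {X : Matrix (Fin N) (Fin ns) ℝ}

/-- A stationary covariance is invariant under the propagator. -/
lemma propagator_mul_covariance {S : Matrix (Fin ns) (Fin ns) ℝ} (hS : A * S + S * Aᵀ = 0) (t : ℝ) :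
    propagator A t * S * (propagator A t)ᵀ = S := by
  ext i j
  have hd : ∀ t, HasDerivAt (fun t => (propagator A t * S * (propagator A t)ᵀ) i j) 0 t := by
    intro t
    have h1 : ∀ a b, HasDerivAt (fun t => (propagator A t * S) a b) ((A * propagator A t * S) a b) t := by
      intro a b
      refine (hasDerivAt_matrix_mul_apply (hasDerivAt_propagator_apply A t)
        (fun a b => hasDerivAt_const t (S a b)) a b (L' := 0)).congr_deriv ?_
      rw [Matrix.mul_zero, add_zero]
    refine (hasDerivAt_matrix_mul_apply h1 (L := fun t => (propagator A t)ᵀ)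
      (L' := (A * propagator A t)ᵀ) (fun a b => hasDerivAt_propagator_apply A t b a) i j).congr_deriv ?_
    rw [commute_propagator, Matrix.transpose_mul]
    have : propagator A t * A * S * (propagator A t)ᵀ + propagator A t * S * (Aᵀ * (propagator A t)ᵀ)
        = propagator A t * (A * S + S * Aᵀ) * (propagator A t)ᵀ := by
      simp only [Matrix.mul_add, Matrix.add_mul, Matrix.mul_assoc]
    rw [this, hS, Matrix.mul_zero, Matrix.zero_mul, Matrix.zero_apply]
  have hconst := is_const_of_deriv_eq_zero (fun t => (hd t).differentiableAt)
    (fun t => (hd t).deriv) t 0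
  simpa [propagator_zero] using hconst

/-- A single trajectory may oscillate, but second moments summed over all rows of `X` are constant
in time. -/
lemma sum_sq_dotProduct_propagator (hS : A * (Xᵀ * X) + (Xᵀ * X) * Aᵀ = 0) (g : Fin ns → ℝ) (t : ℝ) :
    ∑ k, (g ⬝ᵥ propagator A t *ᵥ X k) ^ 2 = g ⬝ᵥ (Xᵀ * X) *ᵥ g := by
  conv_rhs => rw [← propagator_mul_covariance hS t]
  set Y := X * (propagator A t)ᵀ with hY
  have h1 : propagator A t * (Xᵀ * X) * (propagator A t)ᵀ = Yᵀ * Y := by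
    rw [hY, Matrix.transpose_mul, Matrix.transpose_transpose]
    simp only [Matrix.mul_assoc]
  have h2 : ∀ k, propagator A t *ᵥ X k = Y k := by
    intro k
    ext i
    simp only [hY, Matrix.mulVec, Matrix.mul_apply, dotProduct, Matrix.transpose_apply]
    exact Finset.sum_congr rfl fun _ _ => mul_comm _ _
  rw [h1, ← Matrix.mulVec_mulVec, Matrix.dotProduct_mulVec, Matrix.vecMul_transpose]
  rw [dotProduct.eq_1 (Y *ᵥ g)]
  refine Finset.sum_congr rfl fun k _ => ?_
  rw [h2, sq, Matrix.mulVec, dotProduct_comm]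

/-- Each square is at most the conserved sum; `1 + s` replaces `√s`. -/
lemma abs_propagator_mulVec_le (hS : A * (Xᵀ * X) + (Xᵀ * X) * Aᵀ = 0) (k : Fin N) (t : ℝ) :
    ‖propagator A t *ᵥ X k‖ ≤ 1 + ∑ j, (Xᵀ * X) j j := by
  have hnn : ∀ j, 0 ≤ (Xᵀ * X) j j := fun j => by
    rw [Matrix.mul_apply]
    exact Finset.sum_nonneg fun k _ => mul_self_nonneg _
  have hsum : 0 ≤ ∑ j, (Xᵀ * X) j j := Finset.sum_nonneg fun j _ => hnn j
  refine (pi_norm_le_iff_of_nonneg (by linarith)).2 fun i => ?_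
  have h1 := sum_sq_dotProduct_propagator hS (Pi.single i 1) t
  simp only [single_dotProduct, one_mul, Matrix.mulVec_single_one, Matrix.col_apply] at h1
  have h2 := Finset.single_le_sum (f := fun k => (propagator A t *ᵥ X k) i ^ 2)
    (fun _ _ => sq_nonneg _) (Finset.mem_univ k)
  have h3 := Finset.single_le_sum (f := fun j => (Xᵀ * X) j j) (fun j _ => hnn j) (Finset.mem_univ i)
  rw [Real.norm_eq_abs]
  refine abs_le_of_sq_le_sq ?_ (by linarith)
  nlinarith

end StationaryCovariance

/-! ### The schedule of blocks and cycles. -/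

section Schedule

variable (N : ℕ) (τ : ℝ)

/-- Starting times of a schedule whose `l`-th block has length `τ 4 ^ (l / N)`. -/
noncomputable def schedule (l : ℕ) : ℝ := ∑ i ∈ Finset.range l, τ * 4 ^ (i / N)

lemma schedule_succ (l : ℕ) : schedule N τ (l + 1) = schedule N τ l + τ * 4 ^ (l / N) :=
  Finset.sum_range_succ _ _

variable {N τ}

lemma isPartition_schedule (hτ : 0 < τ) : IsPartition (schedule N τ) where
  zero := by simp [schedule]
  strictMono := strictMono_nat_of_lt_succ fun l => by
    rw [schedule_succ]
    have : 0 < τ * 4 ^ (l / N) := by positivity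
    linarith
  tendsto := by
    refine tendsto_atTop_mono (fun l => ?_) (tendsto_natCast_atTop_atTop.atTop_mul_const hτ)
    rw [schedule]
    calc (l : ℝ) * τ = ∑ i ∈ Finset.range l, τ := by simp
      _ ≤ _ := Finset.sum_le_sum fun i _ => le_mul_of_one_le_right hτ.le (one_le_pow₀ (by norm_num))

/-- Cycles of `N` blocks form the coarser partition on which the memory operator works. -/
lemma isPartition_schedule_mul (hτ : 0 < τ) (hN : 0 < N) :
    IsPartition (fun c => schedule N τ (c * N)) where
  zero := by simp [schedule]
  strictMono := (isPartition_schedule hτ).strictMono.comp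
    (strictMono_nat_of_lt_succ fun c => Nat.mul_lt_mul_of_pos_right (Nat.lt_succ_self c) hN)
  tendsto := (isPartition_schedule hτ).tendsto.comp
    (tendsto_atTop_mono (fun c => Nat.le_mul_of_pos_right c hN) tendsto_id)

lemma summable_pow_div (hN : 0 < N) : Summable fun l : ℕ => (((1 : ℝ) / 2) ^ (l / N)) ^ 2 := by
  have : NeZero N := ⟨hN.ne'⟩
  have h1 : Summable fun p : ℕ × Fin N => ((1 : ℝ) / 4) ^ p.1 * 1 :=
    Summable.mul_of_nonneg (g := fun _ : Fin N => (1 : ℝ))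
      (summable_geometric_of_lt_one (by norm_num) (by norm_num)) (Summable.of_finite)
      (fun _ => by positivity) (fun _ => zero_le_one)
  refine ((Nat.divModEquiv N).summable_iff.2 h1).congr fun l => ?_
  simp only [Function.comp_apply, Nat.divModEquiv, Equiv.coe_fn_mk, mul_one]
  rw [← pow_mul, mul_comm, pow_mul]
  norm_num

end Schedule

/-! ### The reference signal and how the plant tracks it. -/

section Reference

variable {ns na N : ℕ} [NeZero N] (A' : Matrix (Fin ns) (Fin ns) ℝ) (X : Matrix (Fin N) (Fin ns) ℝ)
  (τ : ℝ)

/-- The trajectory of `ẋ = A' x` that is played on the `l`-th block. -/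
noncomputable def piece (l : ℕ) (t : ℝ) : Fin ns → ℝ :=
  ((1 : ℝ) / 2) ^ (l / N) • (propagator A' (t - schedule N τ l) *ᵥ X (Fin.ofNat N l))

/-- The reference signal: the trajectories from the rows of `X` in cyclic order, ever longer and
with ever smaller amplitude, so that every cycle has the same energy. -/
noncomputable def reference : Signal (Fin ns) := fun t =>
  piece A' X τ (blockIndex (schedule N τ) t) t

lemma hasDerivAt_piece (l : ℕ) (t : ℝ) :
    HasDerivAt (piece A' X τ l) (A' *ᵥ piece A' X τ l t) t := by
  have h1 := (hasDerivAt_propagator_mulVec A' (X (Fin.ofNat N l)) (t - schedule N τ l)).comp_sub_const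
    t (schedule N τ l)
  rw [piece, Matrix.mulVec_smul]
  exact HasDerivAt.const_smul (((1 : ℝ) / 2) ^ (l / N)) h1

lemma continuous_piece (l : ℕ) : Continuous (piece A' X τ l) :=
  continuous_iff_continuousAt.2 fun t => (hasDerivAt_piece A' X τ l t).continuousAt

variable {A' X τ}

lemma norm_piece_le (hS : A' * (Xᵀ * X) + (Xᵀ * X) * A'ᵀ = 0) (l : ℕ) (t : ℝ) :
    ‖piece A' X τ l t‖ ≤ (1 + ∑ j, (Xᵀ * X) j j) * ((1 : ℝ) / 2) ^ (l / N) := by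
  rw [piece, norm_smul, norm_pow, mul_comm, Real.norm_of_nonneg (by norm_num : (0 : ℝ) ≤ 1 / 2)]
  exact mul_le_mul_of_nonneg_right (abs_propagator_mulVec_le hS _ _) (by positivity)

lemma reference_of_mem (hτ : 0 < τ) {l : ℕ} {t : ℝ} (ht : t ∈ block (schedule N τ) l) :
    reference A' X τ t = piece A' X τ l t := by
  rw [reference, (isPartition_schedule hτ).blockIndex_of_mem ht]

lemma memL2e_reference (hτ : 0 < τ) (hS : A' * (Xᵀ * X) + (Xᵀ * X) * A'ᵀ = 0) :
    MemL2e (reference A' X τ) := by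
  intro i T _
  have hm : Measurable (reference A' X τ) := by
    have h1 : Measurable fun p : ℝ × ℕ => piece A' X τ p.2 p.1 :=
      measurable_from_prod_countable_left fun l => (continuous_piece A' X τ l).measurable
    exact h1.comp (measurable_id.prodMk (isPartition_schedule hτ).measurable_blockIndex)
  refine MemLp.of_bound ((measurable_pi_iff.1 hm i).aestronglyMeasurable)
    (1 + ∑ j, (Xᵀ * X) j j) (Eventually.of_forall fun t => ?_)
  refine ((norm_le_pi_norm _ i).trans (norm_piece_le hS _ t)).trans ?_
  refine mul_le_of_le_one_right ?_ (pow_le_one₀ (by norm_num) (by norm_num))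
  exact (norm_nonneg _).trans (abs_propagator_mulVec_le hS 0 0)

/-- Every cycle of the reference signal has the same second moments. -/
lemma integral_reference_cycle (hτ : 0 < τ) (hS : A' * (Xᵀ * X) + (Xᵀ * X) * A'ᵀ = 0)
    (g : Fin ns → ℝ) (c : ℕ) :
    ∫ t in block (fun c => schedule N τ (c * N)) c, (g ⬝ᵥ reference A' X τ t) ^ 2
      = τ * (g ⬝ᵥ (Xᵀ * X) *ᵥ g) := by
  have hs := isPartition_schedule (N := N) hτ
  have hcont : ∀ k : Fin N, Continuous fun r => (g ⬝ᵥ propagator A' r *ᵥ X k) ^ 2 := fun k =>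
    (continuous_const.dotProduct
      ((continuous_propagator A').matrix_mulVec continuous_const)).pow 2
  have hpc : ∀ l, Continuous fun t => (g ⬝ᵥ piece A' X τ l t) ^ 2 := fun l =>
    (continuous_const.dotProduct (continuous_piece A' X τ l)).pow 2
  have heq : ∀ l, Set.EqOn (fun t => (g ⬝ᵥ reference A' X τ t) ^ 2)
      (fun t => (g ⬝ᵥ piece A' X τ l t) ^ 2) (block (schedule N τ) l) := fun l t ht => by
    simp only [reference_of_mem hτ ht]
  have hint : ∀ l, IntervalIntegrable (fun t => (g ⬝ᵥ reference A' X τ t) ^ 2) volume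
      (schedule N τ l) (schedule N τ (l + 1)) := fun l => by
    rw [intervalIntegrable_iff_integrableOn_Ico_of_le (hs.lt_succ l).le]
    refine IntegrableOn.congr_fun ?_ (heq l).symm measurableSet_block
    exact ((hpc l).integrableOn_Icc).mono_set Set.Ico_subset_Icc_self
  have hblock : ∀ l, ∫ t in (schedule N τ l)..(schedule N τ (l + 1)),
        (g ⬝ᵥ reference A' X τ t) ^ 2
      = ((1 : ℝ) / 4) ^ (l / N)
        * ∫ r in (0 : ℝ)..(τ * 4 ^ (l / N)), (g ⬝ᵥ propagator A' r *ᵥ X (Fin.ofNat N l)) ^ 2 := by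
    intro l
    rw [intervalIntegral.integral_of_le (hs.lt_succ l).le, ← integral_Ico_eq_integral_Ioc,
      setIntegral_congr_fun measurableSet_Ico (heq l), integral_Ico_eq_integral_Ioc,
      ← intervalIntegral.integral_of_le (hs.lt_succ l).le, ← intervalIntegral.integral_const_mul]
    have h1 := intervalIntegral.integral_comp_sub_right (a := schedule N τ l)
      (b := schedule N τ (l + 1)) (fun r => ((1 : ℝ) / 4) ^ (l / N)
        * (g ⬝ᵥ propagator A' r *ᵥ X (Fin.ofNat N l)) ^ 2) (schedule N τ l)
    rw [sub_self, schedule_succ, add_sub_cancel_left] at h1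
    rw [← h1, schedule_succ]
    refine intervalIntegral.integral_congr fun t _ => ?_
    simp only [piece, dotProduct_smul, smul_eq_mul, mul_pow]
    rw [← pow_mul, mul_comm (l / N) 2, pow_mul]
    norm_num
  have hle : schedule N τ (c * N) ≤ schedule N τ ((c + 1) * N) :=
    hs.strictMono.monotone (Nat.mul_le_mul_right N (Nat.le_succ c))
  rw [block, integral_Ico_eq_integral_Ioc, ← intervalIntegral.integral_of_le hle,
    ← intervalIntegral.sum_integral_adjacent_intervals_Ico
      (Nat.mul_le_mul_right N (Nat.le_succ c)) (fun l _ => hint l), Finset.sum_Ico_eq_sum_range,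
    Nat.succ_mul, Nat.add_sub_cancel_left, Finset.sum_range]
  have hterm : ∀ k : Fin N, ∫ t in (schedule N τ (c * N + k))..(schedule N τ (c * N + k + 1)),
        (g ⬝ᵥ reference A' X τ t) ^ 2
      = ((1 : ℝ) / 4) ^ c * ∫ r in (0 : ℝ)..(τ * 4 ^ c), (g ⬝ᵥ propagator A' r *ᵥ X k) ^ 2 := by
    intro k
    have h1 : (c * N + k) / N = c := by
      rw [mul_comm, Nat.mul_add_div (Nat.pos_of_neZero N), Nat.div_eq_of_lt k.2, add_zero]
    have h2 : Fin.ofNat N (c * N + k) = k := by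
      ext
      simp [Fin.ofNat, Nat.mod_eq_of_lt k.2]
    rw [hblock, h1, h2]
  simp only [hterm]
  rw [← Finset.mul_sum, ← intervalIntegral.integral_finsetSum fun k _ =>
    (hcont k).intervalIntegrable _ _]
  -- All blocks of a cycle have equal length, so the sum over `k` can be taken at a common elapsed
  -- time, where it is constant; `4 ^ c` from the length then cancels the squared amplitude.
  simp only [sum_sq_dotProduct_propagator hS]
  rw [intervalIntegral.integral_const, sub_zero, smul_eq_mul, ← mul_assoc, mul_comm _ (τ * _),
    mul_assoc τ, ← mul_pow]
  norm_num

variable {A : Matrix (Fin ns) (Fin ns) ℝ} {B : Matrix (Fin ns) (Fin na) ℝ}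
  {K : Matrix (Fin na) (Fin ns) ℝ}

/-- The plant driven by the feedback input of the reference signal follows that signal up to an
error of finite energy. -/
lemma memL2_reference_sub_plant (hτ : 0 < τ)
    (hS : (A + B * K) * (Xᵀ * X) + (Xᵀ * X) * (A + B * K)ᵀ = 0) {C a : ℝ} (ha : 0 < a)
    (hdecay : ∀ t : ℝ, 0 ≤ t → ∀ v : Fin ns → ℝ,
      ‖propagator A t *ᵥ v‖ ≤ C * Real.exp (-a * t) * ‖v‖) (hC : 0 < C)
    (hCτ : C * Real.exp (-a * τ) ≤ 1 / 4) :
    MemL2 (fun t => reference (A + B * K) X τ t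
      - plant A B (fun s => K *ᵥ reference (A + B * K) X τ s) t) := by
  set A' := A + B * K with hA'
  set u : Signal (Fin na) := fun s => K *ᵥ reference A' X τ s with hu_def
  set D := 1 + ∑ j, (Xᵀ * X) j j with hD
  have hD0 : 0 ≤ D := (norm_nonneg _).trans (abs_propagator_mulVec_le hS 0 0)
  have hs := isPartition_schedule (N := N) hτ
  have hr := memL2e_reference hτ hS
  have hu : MemL2e u := hr.mulVec K
  -- Within a block the reference and the plant receive the same input, so their difference evolves
  -- freely under `A`.
  have hstep : ∀ l, ∀ t ∈ Set.Icc (schedule N τ l) (schedule N τ (l + 1)),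
      piece A' X τ l t - plant A B u t = propagator A (t - schedule N τ l) *ᵥ
        (piece A' X τ l (schedule N τ l) - plant A B u (schedule N τ l)) := by
    intro l t ht
    have h1 := plant_eq_of_trajectory (A := A) (B := B) (u := u) (y := piece A' X τ l)
      (w := fun s => K *ᵥ piece A' X τ l s) (hs.nonneg l) ht.1
      (hu.intervalIntegrable ((hs.nonneg l).trans ht.1))
      (continuous_const.matrix_mulVec (continuous_piece A' X τ l))
      (fun s => (hasDerivAt_piece A' X τ l s).congr_deriv (by
        rw [hA', Matrix.add_mulVec, Matrix.mulVec_mulVec]))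
      (fun s hst => by
        rw [hu_def]
        simp only
        rw [reference_of_mem hτ ⟨hst.1.le, hst.2.trans_le ht.2⟩])
    rw [h1, Matrix.mulVec_sub, Matrix.mulVec_sub]
    abel
  -- With `p ≤ 2 p'`, the old error contributes `8 D p / 4` and the jump at most `D p + D p'`, in
  -- total at most `7 D p'`, so the constant `8` propagates.
  have hbound : ∀ l, ‖piece A' X τ l (schedule N τ l) - plant A B u (schedule N τ l)‖
      ≤ 8 * D * ((1 : ℝ) / 2) ^ (l / N) := by
    intro l
    induction l with
    | zero =>
      have h0 : plant A B u (schedule N τ 0) = 0 := by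
        rw [hs.zero, plant_def, intervalIntegral.integral_same]
      rw [h0, sub_zero]
      refine (norm_piece_le hS 0 _).trans ?_
      exact mul_le_mul_of_nonneg_right (by linarith) (by positivity)
    | succ l ih =>
      set p : ℝ := ((1 : ℝ) / 2) ^ (l / N) with hp
      set p' : ℝ := ((1 : ℝ) / 2) ^ ((l + 1) / N) with hp'
      have hp0 : 0 < p := by positivity
      have hpp' : p ≤ 2 * p' := by
        have h1 : (l + 1) / N ≤ l / N + 1 := by
          rw [Nat.succ_div]
          split_ifs <;> omega
        have h2 : ((1 : ℝ) / 2) ^ (l / N + 1) ≤ p' := pow_le_pow_of_le_one (by norm_num) (by norm_num) h1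
        rw [pow_succ] at h2
        linarith
      have hend := hstep l (schedule N τ (l + 1)) ⟨(hs.lt_succ l).le, le_rfl⟩
      have hlen : τ ≤ schedule N τ (l + 1) - schedule N τ l := by
        rw [schedule_succ, add_sub_cancel_left]
        exact le_mul_of_one_le_right hτ.le (one_le_pow₀ (by norm_num))
      have hprop : ‖piece A' X τ l (schedule N τ (l + 1)) - plant A B u (schedule N τ (l + 1))‖
          ≤ 1 / 4 * (8 * D * p) := by
        rw [hend]
        refine (hdecay _ (hτ.le.trans hlen) _).trans (mul_le_mul ?_ ih (norm_nonneg _) (by norm_num))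
        refine (mul_le_mul_of_nonneg_left (Real.exp_le_exp.2 ?_) hC.le).trans hCτ
        nlinarith
      have hsplit : piece A' X τ (l + 1) (schedule N τ (l + 1)) - plant A B u (schedule N τ (l + 1))
          = piece A' X τ (l + 1) (schedule N τ (l + 1)) - piece A' X τ l (schedule N τ (l + 1))
            + (piece A' X τ l (schedule N τ (l + 1)) - plant A B u (schedule N τ (l + 1))) := by
        abel
      rw [hsplit]
      refine (norm_add_le _ _).trans ((add_le_add (norm_sub_le _ _) hprop).trans ?_)
      have h1 := norm_piece_le (τ := τ) hS (l + 1) (schedule N τ (l + 1))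
      have h2 := norm_piece_le (τ := τ) hS l (schedule N τ (l + 1))
      rw [← hp', ← hD] at h1
      rw [← hp, ← hD] at h2
      have h4 : 0 ≤ D * p' := mul_nonneg hD0 (by positivity)
      have h3 := mul_le_mul_of_nonneg_left hpp' hD0
      linarith
  refine memL2_of_block_decay hs (b := fun l => 8 * D * ((1 : ℝ) / 2) ^ (l / N)) (C := C) ?_ ha ?_ ?_
  · intro i T hT
    exact (hr i T hT).sub (hu.plant i T hT)
  · simp only [mul_pow]
    exact (summable_pow_div (Nat.pos_of_neZero N)).mul_left _
  · intro l t ht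
    rw [reference_of_mem hτ ht, hstep l t ⟨ht.1, ht.2.le⟩]
    exact (hdecay _ (sub_nonneg.2 ht.1) _).trans
      (mul_le_mul_of_nonneg_left (hbound l) (by positivity))

end Reference

/-! ### The destabilizing operator and positivity of the storage function. -/

section Destabilization

variable {ns na : ℕ} {A : Matrix (Fin ns) (Fin ns) ℝ} {B : Matrix (Fin ns) (Fin na) ℝ}
  {lo hi : Fin na → Fin ns → ℝ}

/-- Robust stability excludes stationary covariances compatible with the sector bounds. -/
theorem not_covariance_of_stable {N : ℕ} [NeZero N] (hA : Hurwitz A)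
    (hstable : ∀ π : Signal (Fin ns) → Signal (Fin na × Fin ns),
      Bounded π → Causal π → SectorBounded lo hi π → WellPosed A B π → IOStable A B π)
    (X : Matrix (Fin N) (Fin ns) ℝ) (F : Matrix (Fin na × Fin ns) (Fin ns) ℝ)
    (hS : (A + B * (sumMatrix na ns * F)) * (Xᵀ * X)
      + (Xᵀ * X) * (A + B * (sumMatrix na ns * F))ᵀ = 0)
    (hpos : 0 < ∑ j, (Xᵀ * X) j j)
    (hsec : ∀ i j, (F (i, j) - Pi.single j (ctr lo hi i j)) ⬝ᵥ
          (Xᵀ * X) *ᵥ (F (i, j) - Pi.single j (ctr lo hi i j))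
        ≤ rad lo hi i j ^ 2 * (Xᵀ * X) j j) : False := by
  obtain ⟨C, a, hC, ha, hdecay⟩ := hA.exp_decay
  -- Every block lasts at least `τ`, so the tracking error shrinks at least fourfold over each.
  obtain ⟨τ, hCτ, hτ⟩ : ∃ τ : ℝ, C * Real.exp (-a * τ) ≤ 1 / 4 ∧ 0 < τ := by
    have h1 : Tendsto (fun τ : ℝ => C * Real.exp (-a * τ)) atTop (nhds (C * 0)) := by
      refine Tendsto.const_mul C (Real.tendsto_exp_atBot.comp ?_)
      exact tendsto_id.const_mul_atTop_of_neg (neg_neg_of_pos ha)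
    rw [mul_zero] at h1
    exact ((h1.eventually_le_const (by norm_num : (0 : ℝ) < 1 / 4)).and (eventually_gt_atTop 0)).exists
  set W := sumMatrix na ns with hW
  set A' := A + B * (W * F) with hA'
  set σ : ℕ → ℝ := fun c => schedule N τ (c * N) with hσ_def
  set ξ : Signal (Fin ns) := reference A' X τ with hξ_def
  set G : Matrix (Fin na × Fin ns) (Fin ns) ℝ :=
    Matrix.of fun p => F p - Pi.single p.2 (ctr lo hi p.1 p.2) with hG
  set η : Signal (Fin na × Fin ns) := fun t => G *ᵥ ξ t with hη_def
  have hσ : IsPartition σ := isPartition_schedule_mul hτ (Nat.pos_of_neZero N)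
  have hξ : MemL2e ξ := memL2e_reference hτ hS
  have hη : MemL2e η := hξ.mulVec G
  have hξint : ∀ c j, ∫ t in block σ c, ξ t j ^ 2 = τ * (Xᵀ * X) j j := by
    intro c j
    have := integral_reference_cycle hτ hS (Pi.single j 1) c
    simpa only [single_dotProduct, one_mul, Matrix.mulVec_single_one, Matrix.col_apply] using this
  have hηint : ∀ c i j, ∫ t in block σ c, η t (i, j) ^ 2
      = τ * (G (i, j) ⬝ᵥ (Xᵀ * X) *ᵥ G (i, j)) := fun c i j => integral_reference_cycle hτ hS _ c
  have htemp : IsTemplate lo hi σ ξ η := by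
    refine ⟨hσ, hξ, hη, fun m i j => ?_⟩
    rw [hξint, hηint, mul_left_comm]
    exact mul_le_mul_of_nonneg_left (hsec i j) hτ.le
  refine htemp.not_ioStable (u := fun t => (W * F) *ᵥ ξ t) (hξ.mulVec _)
    (memL2_reference_sub_plant hτ hS ha hdecay hC hCτ) ?_ ?_
    (hstable _ htemp.bounded (sectorOp_causal hσ) htemp.sectorBounded
      (sectorOp_wellPosed A B hσ hη))
  · set f : Signal (Fin na) := fun t => (W * F) *ᵥ ξ t - W *ᵥ sectorOp lo hi σ ξ η ξ t with hf
    have hfe : MemL2e f := by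
      have h1 : MemL2e (sectorOp lo hi σ ξ η ξ) := fun p T hT =>
        ((hξ p.2 T hT).const_mul _).add (memL2e_replay hσ hη _ p T hT)
      exact fun i T hT => ((hξ.mulVec (W * F)) i T hT).sub ((h1.mulVec W) i T hT)
    -- Fed with its own template the operator has coefficient `1` and returns `F ξ` exactly, except
    -- during the first cycle, when nothing has been recorded.
    have hf0 : ∀ t, 0 ≤ t → t ∉ block σ 0 → f t = 0 := by
      intro t ht ht0
      rw [hf]
      beta_reduce
      rw [← Matrix.mulVec_mulVec, ← Matrix.mulVec_sub]
      suffices h : F *ᵥ ξ t - sectorOp lo hi σ ξ η ξ t = 0 by rw [h, Matrix.mulVec_zero]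
      ext ⟨i, j⟩
      obtain ⟨m, hm⟩ : ∃ m, t ∈ block σ (m + 1) := by
        rcases h : blockIndex σ t with _ | m
        · exact absurd ((hσ.blockIndex_eq_iff ht).1 h) ht0
        · exact ⟨m, (hσ.blockIndex_eq_iff ht).1 h⟩
      have hηt : η t (i, j) = (F *ᵥ ξ t) (i, j) - ctr lo hi i j * ξ t j := by
        change (F (i, j) - Pi.single j (ctr lo hi i j)) ⬝ᵥ ξ t = _
        rw [sub_dotProduct, single_dotProduct]
        rfl
      have hrep : replay σ η (memCoeff σ ξ ξ) t (i, j) = η t (i, j) := by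
        rw [replay_of_mem_block_succ hσ _ hm]
        -- Here the coefficient is not `1`, but the sector bound forces `η` to vanish in this
        -- component.
        by_cases hSj : (Xᵀ * X) j j = 0
        · have hη0 : η t (i, j) = 0 := by
            have h1 := hsec i j
            rw [hSj, mul_zero] at h1
            change G (i, j) ⬝ᵥ piece A' X τ _ t = 0
            rw [piece, dotProduct_smul]
            set l := blockIndex (schedule N τ) t
            have h2 := sum_sq_dotProduct_propagator hS (G (i, j)) (t - schedule N τ l)
            have h3 := Finset.single_le_sum
              (f := fun k => (G (i, j) ⬝ᵥ propagator A' (t - schedule N τ l) *ᵥ X k) ^ 2)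
              (fun _ _ => sq_nonneg _) (Finset.mem_univ (Fin.ofNat N l))
            rw [h2] at h3
            have h4 := pow_eq_zero_iff two_ne_zero |>.1 (le_antisymm (h3.trans h1) (sq_nonneg _))
            rw [h4, smul_zero]
          rw [hη0, mul_zero]
        · have : memCoeff σ ξ ξ m j = 1 := by
            simp only [memCoeff, ← sq]
            rw [hξint]
            exact div_self (mul_ne_zero hτ.ne' hSj)
          rw [this, one_mul]
      rw [Pi.sub_apply, sectorOp, hrep, hηt]
      simp
    intro i
    have h1 : (fun t => f t i) =ᵐ[volume.restrict (Set.Ici (0 : ℝ))]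
        (block σ 0).indicator fun t => f t i := by
      filter_upwards [ae_restrict_mem measurableSet_Ici] with t ht
      by_cases ht0 : t ∈ block σ 0
      · rw [Set.indicator_of_mem ht0]
      · rw [Set.indicator_of_notMem ht0, hf0 t ht ht0, Pi.zero_apply]
    rw [memLp_congr_ae h1, memLp_indicator_iff_restrict measurableSet_block,
      Measure.restrict_restrict_of_subset (hσ.block_subset_Ici 0)]
    exact hfe.memLp_block hσ 0 i
  · set E := τ * ∑ j, (Xᵀ * X) j j with hE
    have hE0 : 0 < E := mul_pos hτ hpos
    have hen : ∀ M, energyUpTo (σ M) ξ = M * E := by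
      intro M
      have hint : ∀ c, IntervalIntegrable (fun t => ∑ j, ξ t j ^ 2) volume (σ c) (σ (c + 1)) := by
        intro c
        rw [intervalIntegrable_iff_integrableOn_Ico_of_le (hσ.lt_succ c).le]
        exact integrable_finsetSum _ fun j _ => (hξ.memLp_block hσ c j).integrable_sq
      rw [energyUpTo, integral_Icc_eq_integral_Ioc, ← intervalIntegral.integral_of_le (hσ.nonneg M)]
      conv_lhs => rw [← hσ.zero]
      rw [← intervalIntegral.sum_integral_adjacent_intervals fun c _ => hint c]
      have hc : ∀ c, ∫ t in (σ c)..(σ (c + 1)), ∑ j, ξ t j ^ 2 = E := by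
        intro c
        rw [intervalIntegral.integral_of_le (hσ.lt_succ c).le, ← integral_Ico_eq_integral_Ioc]
        have := integral_finsetSum (μ := volume.restrict (block σ c)) Finset.univ
          (f := fun j t => ξ t j ^ 2) fun j _ => (hξ.memLp_block hσ c j).integrable_sq
        refine this.trans ?_
        simp only [hξint]
        rw [hE, Finset.mul_sum]
      simp [hc]
    intro D
    obtain ⟨M, hM⟩ := exists_nat_gt (D / E)
    exact ⟨σ M, hσ.nonneg M, by rwa [hen, ← div_lt_iff₀ hE0]⟩

lemma neg_sum_abs_mul_le_quadForm (P : Matrix (Fin ns) (Fin ns) ℝ) (v : Fin ns → ℝ) :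
    -((∑ i, ∑ j, |P i j|) * ∑ i, v i ^ 2) ≤ v ⬝ᵥ P *ᵥ v := by
  have hle : ∀ k, v k ^ 2 ≤ ∑ i, v i ^ 2 := fun k =>
    Finset.single_le_sum (f := fun i => v i ^ 2) (fun _ _ => sq_nonneg _) (Finset.mem_univ k)
  generalize ∑ i, v i ^ 2 = s at hle ⊢
  simp only [dotProduct, Matrix.mulVec, Finset.mul_sum, Finset.sum_mul, ← Finset.sum_neg_distrib]
  refine Finset.sum_le_sum fun i _ => Finset.sum_le_sum fun j _ => ?_
  have h1 : |v i * (P i j * v j)| ≤ |P i j| * s := by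
    rw [abs_mul, abs_mul, mul_left_comm]
    refine mul_le_mul_of_nonneg_left ?_ (abs_nonneg _)
    have h2 := hle i
    have h3 := hle j
    rw [← sq_abs] at h2 h3
    nlinarith [sq_nonneg (|v i| - |v j|)]
  linarith [neg_abs_le (v i * (P i j * v j))]

/-- Stability of the loop with the static gains at the sector centres forces the storage function to
be nonnegative. -/
theorem posSemidef_of_stable (hA : Hurwitz A)
    (hstable : ∀ π : Signal (Fin ns) → Signal (Fin na × Fin ns),
      Bounded π → Causal π → SectorBounded lo hi π → WellPosed A B π → IOStable A B π)
    {P : Matrix (Fin ns) (Fin ns) ℝ} (hP : P.IsSymm) {lam : Fin na → Fin ns → ℝ}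
    (hlam : ∀ i j, 0 ≤ lam i j) (hneg : (-coreLMI A B lo hi P lam).PosDef) : P.PosSemidef := by
  refine Matrix.PosSemidef.of_dotProduct_mulVec_nonneg ?_ fun v => ?_
  · rw [Matrix.IsHermitian, Matrix.conjTranspose_eq_transpose_of_trivial, hP.eq]
  rw [star_trivial]
  by_contra! hv
  obtain ⟨C, a, hC, ha, hdecay⟩ := hA.exp_decay
  set K := centerGain lo hi with hK
  set x : Signal (Fin ns) := fun t => propagator (A + B * K) t *ᵥ v with hx
  have hxd : ∀ t, HasDerivAt x ((A + B * K) *ᵥ x t) t := hasDerivAt_propagator_mulVec _ v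
  have hxc : Continuous x := continuous_iff_continuousAt.2 fun t => (hxd t).continuousAt
  have hxe : MemL2e x := ContinuousOn.memL2e fun t _ => hxc.continuousOn
  have hσ : IsPartition (fun m : ℕ => (m : ℝ)) :=
    ⟨Nat.cast_zero, Nat.strictMono_cast, tendsto_natCast_atTop_atTop⟩
  have h0 : ∀ ι : Type, MemL2e (fun _ _ => 0 : Signal ι) := fun ι i T hT => MemLp.zero
  -- Zero templates reduce the operator to the static centre gains.
  have htemp : IsTemplate lo hi (fun m : ℕ => (m : ℝ)) (fun _ _ => 0) (fun _ _ => 0) :=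
    ⟨hσ, h0 _, h0 _, fun m i j => by simp⟩
  have hue : MemL2e (fun t => K *ᵥ x t) := hxe.mulVec K
  refine htemp.not_ioStable (x := x) (u := fun t => K *ᵥ x t) hue ?_ ?_ ?_
    (hstable _ htemp.bounded (sectorOp_causal hσ) htemp.sectorBounded
      (sectorOp_wellPosed A B hσ (h0 _)))
  -- The plant starts at zero and the trajectory at `v`; the discrepancy is the free response, which
  -- has finite energy.
  · have hd : ∀ t, 0 ≤ t → x t - plant A B (fun t => K *ᵥ x t) t = propagator A t *ᵥ v := by
      intro t ht
      have h1 := plant_eq_of_trajectory (A := A) (B := B) (u := fun t => K *ᵥ x t) (y := x)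
        (w := fun t => K *ᵥ x t) le_rfl ht (hue.intervalIntegrable ht)
        (continuous_const.matrix_mulVec hxc)
        (fun s => (hxd s).congr_deriv (by rw [Matrix.add_mulVec, Matrix.mulVec_mulVec (x s) B K]))
        (fun s _ => rfl)
      have h2 : plant A B (fun t => K *ᵥ x t) 0 = 0 := by
        rw [plant_def, intervalIntegral.integral_same]
      have h3 : x 0 = v := by rw [hx]; simp [propagator_zero]
      rw [h1, h2, h3, sub_zero, zero_sub, Matrix.mulVec_neg]
      abel
    refine memL2_of_block_decay hσ (C := C * ‖v‖) (b := fun l => Real.exp (-a * l)) ?_ ha ?_ ?_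
    · intro i T hT
      exact (hxe i T hT).sub (hue.plant i T hT)
    · refine (summable_geometric_of_lt_one (Real.exp_pos (-(2 * a))).le
        (Real.exp_lt_one_iff.2 (by linarith))).congr fun l => ?_
      rw [← Real.exp_nat_mul, ← Real.exp_nat_mul]
      congr 1
      push_cast
      ring
    · intro l t ht
      have ht0 := hσ.block_subset_Ici l ht
      rw [hd t ht0]
      refine (hdecay t ht0 v).trans (le_of_eq ?_)
      rw [show -a * t = -a * (t - l) + -a * l by ring, Real.exp_add]
      ring
  · have h1 : ∀ t, K *ᵥ x t - sumMatrix na ns *ᵥ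
        sectorOp lo hi (fun m : ℕ => (m : ℝ)) (fun _ _ => 0) (fun _ _ => 0) x t = 0 := by
      intro t
      have h2 : replay (fun m : ℕ => (m : ℝ)) (fun _ _ => 0 : Signal (Fin na × Fin ns))
          (memCoeff (fun m : ℕ => (m : ℝ)) (fun _ _ => 0) x) t = 0 := by
        ext p
        simp [replay]
      rw [sumMatrix_mulVec_sectorOp, h2, Matrix.mulVec_zero, add_zero, sub_self]
    simp only [h1]
    exact fun i => MemLp.zero
  · set V : ℝ → ℝ := fun t => x t ⬝ᵥ P *ᵥ x t with hV
    have hVd : ∀ t, HasDerivAt V (2 * (x t ⬝ᵥ P *ᵥ ((A + B * K) *ᵥ x t))) t := by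
      intro t
      have hPx : HasDerivAt (fun t => P *ᵥ x t) (P *ᵥ ((A + B * K) *ᵥ x t)) t := by
        have := HasDerivAt.matrix_mulVec (M := fun _ => P) (M' := 0)
          (fun i j => hasDerivAt_const t (P i j)) (hxd t)
        rwa [Matrix.zero_mulVec, zero_add] at this
      rw [hasDerivAt_pi] at hPx
      have h1 := HasDerivAt.fun_sum (u := Finset.univ) fun i _ =>
        ((hasDerivAt_pi.1 (hxd t) i).mul (hPx i))
      refine h1.congr_deriv ?_
      rw [Finset.sum_add_distrib, two_mul]
      congr 1
      change ((A + B * K) *ᵥ x t) ⬝ᵥ (P *ᵥ x t) = _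
      rw [Matrix.dotProduct_mulVec (x t), ← Matrix.mulVec_transpose, hP.eq, dotProduct_comm]
    have hVle : ∀ t, 2 * (x t ⬝ᵥ P *ᵥ ((A + B * K) *ᵥ x t)) ≤ 0 := by
      intro t
      -- At the centre `q = c x` each sector term equals `rad² xⱼ² ≥ 0`, so negativity of the core
      -- inequality leaves `V' ≤ 0`.
      set w : Fin ns ⊕ Fin na × Fin ns → ℝ :=
        Sum.elim (x t) fun p => ctr lo hi p.1 p.2 * x t p.2 with hw
      have h1 := hneg.posSemidef.dotProduct_mulVec_nonneg w
      rw [star_trivial, Matrix.neg_mulVec, dotProduct_neg, coreLMI_quadForm A B lo hi hP,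
        multiplier_quadForm] at h1
      have h2 : sumMatrix na ns *ᵥ (w ∘ Sum.inr) = K *ᵥ x t := by
        ext i
        rw [sumMatrix_mulVec]
        rfl
      have h3 : w ∘ Sum.inl = x t := rfl
      rw [h2, h3, Matrix.mulVec_mulVec (x t) B K, ← Matrix.add_mulVec] at h1
      have h4 : 0 ≤ ∑ i, ∑ j, lam i j *
          ((rad lo hi i j ^ 2 - ctr lo hi i j ^ 2) * w (Sum.inl j) ^ 2
            + 2 * ctr lo hi i j * w (Sum.inr (i, j)) * w (Sum.inl j) - w (Sum.inr (i, j)) ^ 2) := by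
        refine Finset.sum_nonneg fun i _ => Finset.sum_nonneg fun j _ => mul_nonneg (hlam i j) ?_
        simp only [hw, Sum.elim_inl, Sum.elim_inr]
        nlinarith [mul_nonneg (sq_nonneg (rad lo hi i j)) (sq_nonneg (x t j))]
      linarith
    have hanti : Antitone V := antitone_of_deriv_nonpos (fun t => (hVd t).differentiableAt)
      fun t => by rw [(hVd t).deriv]; exact hVle t
    set L := (∑ i, ∑ j, |P i j|) + 1 with hL
    have hL0 : 0 < L := by positivity
    set δ := -(v ⬝ᵥ P *ᵥ v) / L with hδ
    have hδ0 : 0 < δ := div_pos (neg_pos.2 hv) hL0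
    -- From `-L |x|² ≤ V t ≤ V 0 < 0` the state stays away from the origin.
    have hlow : ∀ t, 0 ≤ t → δ ≤ ∑ i, x t i ^ 2 := by
      intro t ht
      have h1 : V t ≤ v ⬝ᵥ P *ᵥ v := by
        have h2 : V 0 = v ⬝ᵥ P *ᵥ v := by simp [hV, hx, propagator_zero]
        rw [← h2]
        exact hanti ht
      have h3 := neg_sum_abs_mul_le_quadForm P (x t)
      have h4 : 0 ≤ ∑ i, x t i ^ 2 := Finset.sum_nonneg fun i _ => sq_nonneg _
      rw [hδ, div_le_iff₀ hL0, hL]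
      have h5 : V t = x t ⬝ᵥ P *ᵥ x t := rfl
      nlinarith
    intro D
    refine ⟨|D| / δ + 1, by positivity, ?_⟩
    have hT : 0 ≤ |D| / δ + 1 := by positivity
    have h1 : ∫ _ in Set.Icc 0 (|D| / δ + 1), δ ≤ energyUpTo (|D| / δ + 1) x := by
      refine setIntegral_mono_on (integrable_const _) ?_ measurableSet_Icc fun t ht => hlow t ht.1
      exact integrable_finsetSum _ fun i _ => (hxe i _ hT).integrable_sq
    rw [setIntegral_const, Real.volume_real_Icc_of_le hT, sub_zero, smul_eq_mul, add_mul,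
      div_mul_cancel₀ _ hδ0.ne'] at h1
    linarith [le_abs_self D]

end Destabilization

end SectorLoop

/-! ### Assembly of the two alternatives. -/

theorem mainTheorem3 {na ns : ℕ} (A : Matrix (Fin ns) (Fin ns) ℝ) (B : Matrix (Fin ns) (Fin na) ℝ)
    (hA : SectorLoop.Hurwitz A)
    (lo hi : Fin na → Fin ns → ℝ) (hξ : ∀ i j, lo i j ≤ hi i j)
    (hstable : ∀ π : SectorLoop.Signal (Fin ns) → SectorLoop.Signal (Fin na × Fin ns),
      SectorLoop.Bounded π → SectorLoop.Causal π → SectorLoop.SectorBounded lo hi π →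
      SectorLoop.WellPosed A B π → SectorLoop.IOStable A B π) :
    ∃ (P : Matrix (Fin ns) (Fin ns) ℝ) (lam : Fin na → Fin ns → ℝ) (γ : ℝ),
      P.PosSemidef ∧ (∀ i j, 0 ≤ lam i j) ∧ 0 < γ ∧ SectorLoop.SDP A B lo hi P lam γ := by
  by_cases h : ∃ (P : Matrix (Fin ns) (Fin ns) ℝ) (lam : Fin na → Fin ns → ℝ), P.IsSymm ∧
      (∀ i j, 0 ≤ lam i j) ∧ (-SectorLoop.coreLMI A B lo hi P lam).PosDef
  · obtain ⟨P, lam, hP, hlam, hneg⟩ := h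
    obtain ⟨γ, hγ, hSDP⟩ := SectorLoop.exists_SDP_of_coreLMI A B lo hi hP lam hneg
    exact ⟨P, lam, γ, SectorLoop.posSemidef_of_stable hA hstable hP hlam hneg, hlam, hγ, hSDP⟩
  · obtain ⟨m, hm, X, F, hS, hpos, hsec⟩ := SectorLoop.coreLMI_alternative A B lo hi h
    -- The cyclic schedule needs the rows numbered; renumbering does not change the covariance.
    have hX : (X.submatrix (Fintype.equivFin m).symm id)ᵀ * X.submatrix (Fintype.equivFin m).symm id
        = Xᵀ * X := by
      rw [Matrix.transpose_submatrix, Matrix.submatrix_mul_equiv, Matrix.submatrix_id_id]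
    have hne : NeZero (Fintype.card m) := by
      refine ⟨fun h0 => ?_⟩
      have := Fintype.card_eq_zero_iff.1 h0
      simp [Matrix.mul_apply] at hpos
    rw [Matrix.mul_assoc B] at hS
    exact (SectorLoop.not_covariance_of_stable hA hstable
      (X.submatrix (Fintype.equivFin m).symm id) F (by rw [hX]; exact hS) (by rw [hX]; exact hpos)
      (by rw [hX]; exact hsec)).elim
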